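/- Let $\Bbbk$ be a field and let $B$ be a bialgebra over $\Bbbk$ which is finite-dimensional or, more generally, left Artinian as a ring. Write $\Delta(x)=x_1\otimes x_2$ for the comultiplication, $\varepsilon$ for the counit, and $B^+=\ker\varepsilon$. Put $$B\oslash B:=\frac{B\otimes B}{(B\otimes B)\,\Delta(B^+)},$$ denote by $x\oslash y$ the class of $x\otimes y$, and let $i_B\colon B\to B\oslash B$, $x\mapsto x\oslash 1$. The space $B\oslash B$ is a coalgebra with $\Delta(x\oslash y)=(x_1\oslash y_2)\otimes(x_2\oslash y_1)$ and $\varepsilon(x\oslash y)=\varepsilon(x)\varepsilon(y)$. Let $$\textstyle\int_l{}^{\star}B:=\{f\in (B\oslash B)^*\mid x_1f(x_2\oslash y)\oslash 1=f(x\oslash y_1)\,y_2\oslash 1\ \text{ for all }x,y\in B\}$$ be the space of left integrals in the pre-dual ${}^\star B=(B\oslash B)^*$, and let $$\textstyle\int_l(B\oslash B)^*:=\{f\in (B\oslash B)^*\mid \mu*f=\mu(1\oslash 1)f\ \text{ for all }\mu\in(B\oslash B)^*\}$$ be the space of usual left integrals, where $*$ is the convolution product. For a Hopf algebra $H$ let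 $\int_l H^*:=\{\tau\in H^*\mid \mu*\tau=\mu(1)\tau\ \text{ for all }\mu\in H^*\}$. A Hopf envelope of $B$ is a Hopf algebra $\mathrm{H}(B)$ with a bialgebra map $q_B\colon B\to \mathrm{H}(B)$ through which every bialgebra map from $B$ to a Hopf algebra factors uniquely; let $\widehat{q_B}\colon B\oslash B\to \mathrm{H}(B)$, $x\oslash y\mapsto q_B(x)\,S(q_B(y))$, where $S$ is the antipode of $\mathrm{H}(B)$. Then $B$ has a Hopf envelope, which can be realised as the quotient $q_B\colon B\to B/\ker(i_B)$. It is finite-dimensional, there is a non-zero $\tau\in\int_l \mathrm{H}(B)^*$, and for every such $\tau$ $$\textstyle\int_l{}^{\star}B=\int_l(B\oslash B)^*=\Bbbk\lambda,\qquad \lambda:=\tau\circ\widehat{q_B},$$ and this space is one-dimensional. -/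

import Mathlib

open scoped TensorProduct

universe u v

noncomputable section

namespace BialgIntegral

section Oslash

variable (k : Type v) (B : Type u) [Field k] [Ring B] [Bialgebra k B]

/-- The subspace `(B ⊗ B) Δ(B⁺)` of `B ⊗ B`, where `B⁺ = ker ε`: the left ideal of the algebra
`B ⊗ B` generated by `Δ(B⁺)`. -/
def oslashIdeal : Ideal (B ⊗[k] B) :=
  Ideal.span {z | ∃ b : B, Coalgebra.counit (R := k) b = 0 ∧ Coalgebra.comul (R := k) b = z}

/-- `B ⊘ B = (B ⊗ B) / (B ⊗ B) Δ(B⁺)`. -/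
def Oslash : Type u := (B ⊗[k] B) ⧸ (oslashIdeal k B).restrictScalars k

instance : AddCommGroup (Oslash k B) :=
  inferInstanceAs (AddCommGroup ((B ⊗[k] B) ⧸ (oslashIdeal k B).restrictScalars k))

instance : Module k (Oslash k B) :=
  inferInstanceAs (Module k ((B ⊗[k] B) ⧸ (oslashIdeal k B).restrictScalars k))

/-- The canonical projection `B ⊗ B → B ⊘ B`. -/
def oslashMk : (B ⊗[k] B) →ₗ[k] Oslash k B := ((oslashIdeal k B).restrictScalars k).mkQ

/-- A linear map on `B ⊗ B` that kills `(B ⊗ B) Δ(B⁺)`, as a linear map on `B ⊘ B`. -/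
def oslashLift {M : Type*} [AddCommGroup M] [Module k M] (f : (B ⊗[k] B) →ₗ[k] M)
    (hf : ∀ t ∈ oslashIdeal k B, f t = 0) : Oslash k B →ₗ[k] M :=
  ((oslashIdeal k B).restrictScalars k).liftQ f (fun t ht => hf t ht)

variable {B} in
/-- The class `x ⊘ y` of `x ⊗ y` in `B ⊘ B`, as a bilinear map. -/
def oslash : B →ₗ[k] B →ₗ[k] Oslash k B :=
  (TensorProduct.mk k B B).compr₂ (oslashMk k B)

/-- The canonical map `i_B : B → B ⊘ B`, `x ↦ x ⊘ 1`. -/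
def iMap : B →ₗ[k] Oslash k B := (oslash k).flip (1 : B)

/-- The comultiplication of `B ⊗ B^cop`,
`x ⊗ y ↦ (x₁ ⊗ y₂) ⊗ (x₂ ⊗ y₁)`, as an algebra map. -/
def copComul : (B ⊗[k] B) →ₐ[k] (B ⊗[k] B) ⊗[k] (B ⊗[k] B) :=
  (Algebra.TensorProduct.tensorTensorTensorComm k k k k B B B B).toAlgHom.comp
    (Algebra.TensorProduct.map (Bialgebra.comulAlgHom k B)
      ((Algebra.TensorProduct.comm k B B).toAlgHom.comp (Bialgebra.comulAlgHom k B)))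

variable {k B}

lemma oslashMk_tmul (x y : B) : oslashMk k B (x ⊗ₜ[k] y) = oslash k x y := rfl

lemma oslashLift_mk {M : Type*} [AddCommGroup M] [Module k M] (f : (B ⊗[k] B) →ₗ[k] M)
    (hf : ∀ t ∈ oslashIdeal k B, f t = 0) (t : B ⊗[k] B) :
    oslashLift k B f hf (oslashMk k B t) = f t := rfl

lemma oslashLift_oslash {M : Type*} [AddCommGroup M] [Module k M] (f : (B ⊗[k] B) →ₗ[k] M)
    (hf : ∀ t ∈ oslashIdeal k B, f t = 0) (x y : B) :
    oslashLift k B f hf (oslash k x y) = f (x ⊗ₜ[k] y) := rfl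

lemma eq_zero_of_mem_oslashIdeal {M : Type*} [AddCommGroup M] [Module k M]
    (f : (B ⊗[k] B) →ₗ[k] M)
    (hf : ∀ (t : B ⊗[k] B) (b : B), f (t * Coalgebra.comul (R := k) b)
      = Coalgebra.counit (R := k) b • f t) :
    ∀ t ∈ oslashIdeal k B, f t = 0 := by
  intro t ht
  refine Submodule.span_induction (p := fun t _ => ∀ s : B ⊗[k] B, f (s * t) = 0)
    ?_ ?_ ?_ ?_ ht 1 |> fun h => by simpa using h
  · rintro _ ⟨b, hb, rfl⟩ s
    rw [hf, hb, zero_smul]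
  · simp
  · intro x y _ _ hx hy s
    rw [mul_add, map_add, hx, hy, add_zero]
  · intro a x _ hx s
    rw [smul_eq_mul, ← mul_assoc, hx]

lemma oslashMk_mul_comul (t : B ⊗[k] B) (b : B) :
    oslashMk k B (t * Coalgebra.comul (R := k) b)
      = Coalgebra.counit (R := k) b • oslashMk k B t := by
  have hmem : t * (Coalgebra.comul (R := k)
      (b - algebraMap k B (Coalgebra.counit (R := k) b))) ∈ oslashIdeal k B :=
    Ideal.mul_mem_left _ _ (Ideal.subset_span ⟨_, by simp, rfl⟩)
  have h0 : oslashMk k B (t * (Coalgebra.comul (R := k)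
      (b - algebraMap k B (Coalgebra.counit (R := k) b)))) = 0 :=
    (Submodule.Quotient.mk_eq_zero _).2 hmem
  rw [map_sub, Bialgebra.comul_algebraMap, mul_sub, map_sub, sub_eq_zero] at h0
  rw [h0, ← Algebra.commutes, ← Algebra.smul_def, map_smul]

/-- The rearrangement `a ⊗ ((p ⊗ q) ⊗ c) ↦ (a ⊗ c) ⊗ (p ⊗ q)`. -/
def reorder : B ⊗[k] ((B ⊗[k] B) ⊗[k] B) →ₗ[k] (B ⊗[k] B) ⊗[k] (B ⊗[k] B) :=
    (TensorProduct.assoc k B B (B ⊗[k] B)).symm.toLinearMap ∘ₗ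
      (TensorProduct.comm k (B ⊗[k] B) B).toLinearMap.lTensor B

lemma map_comul_comul : TensorProduct.map (Coalgebra.comul (R := k) (A := B)) (Coalgebra.comul (R := k) (A := B)) ∘ₗ
      Coalgebra.comul (R := k) (A := B) =
   (TensorProduct.assoc k B B (B ⊗[k] B)).symm.toLinearMap ∘ₗ
   (TensorProduct.assoc k B B B).toLinearMap.lTensor B ∘ₗ
     ((Coalgebra.comul (R := k) (A := B)).rTensor B).lTensor B ∘ₗ
          (Coalgebra.comul (R := k) (A := B)).lTensor B ∘ₗ Coalgebra.comul (R := k) (A := B) := by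
  simp only [coassoc_simps]

lemma copComul_comul (b : B) : copComul k B (Coalgebra.comul (R := k) b) =
    reorder (k := k) (B := B) (((Coalgebra.comul (R := k) (A := B)).rTensor B).lTensor B
          ((Coalgebra.comul (R := k) (A := B)).lTensor B (Coalgebra.comul (R := k) b))) := by
  have h1 : ∀ u : B ⊗[k] B, copComul k B u =
      TensorProduct.tensorTensorTensorComm k B B B B ((TensorProduct.comm k B B).toLinearMap.lTensor (B ⊗[k] B) (TensorProduct.map (Coalgebra.comul (R := k) (A := B)) (Coalgebra.comul (R := k) (A := B)) u)) := by
    intro u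
    induction u with
    | zero => simp
    | add x y hx hy => simp only [map_add, hx, hy]
    | tmul x y => rfl
  have h2 := DFunLike.congr_fun (map_comul_comul (k := k) (B := B)) b
  simp only [LinearMap.comp_apply] at h2
  rw [h1, h2]
  generalize ((Coalgebra.comul (R := k) (A := B)).rTensor B).lTensor B _ = w
  induction w with
  | zero => simp
  | add x y hx hy => simp only [map_add, hx, hy]
  | tmul a v =>
    induction v with
    | zero => simp
    | add x y hx hy => simp only [map_add, TensorProduct.tmul_add, hx, hy]
    | tmul v c =>
      induction v with
      | zero => simp
      | add x y hx hy => simp only [map_add, TensorProduct.tmul_add, TensorProduct.add_tmul, hx, hy]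
      | tmul p q => rfl

lemma map_oslashMk_mul_copComul (T : (B ⊗[k] B) ⊗[k] (B ⊗[k] B)) (b : B) :
    TensorProduct.map (oslashMk k B) (oslashMk k B)
        (T * copComul k B (Coalgebra.comul (R := k) b))
      = Coalgebra.counit (R := k) b •
        TensorProduct.map (oslashMk k B) (oslashMk k B) T := by
  induction T with
  | zero => simp
  | add x y hx hy => rw [add_mul, map_add, map_add, hx, hy, smul_add]
  | tmul t s =>
    have h : ∀ w : B ⊗[k] (B ⊗[k] B),
        TensorProduct.map (oslashMk k B) (oslashMk k B) ((t ⊗ₜ[k] s) *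
          reorder (((Coalgebra.comul (R := k) (A := B)).rTensor B).lTensor B w))
        = oslashMk k B (t * (TensorProduct.lid k B).toLinearMap.lTensor B
            (((Coalgebra.counit (R := k) (A := B)).rTensor B).lTensor B w)) ⊗ₜ[k]
            oslashMk k B s := by
      intro w
      induction w with
      | zero => simp
      | add x y hx hy => simp only [map_add, mul_add, TensorProduct.add_tmul, hx, hy]
      | tmul a v =>
        induction v with
        | zero => simp
        | add x y hx hy =>
          simp only [map_add, mul_add, TensorProduct.tmul_add, TensorProduct.add_tmul, hx, hy]
        | tmul p c =>
          have h3 : ∀ z : B ⊗[k] B, reorder (a ⊗ₜ[k] (z ⊗ₜ[k] c)) = (a ⊗ₜ[k] c) ⊗ₜ[k] z :=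
            fun _ => rfl
          simp only [LinearMap.lTensor_tmul, LinearMap.rTensor_tmul, h3,
            Algebra.TensorProduct.tmul_mul_tmul, TensorProduct.map_tmul, oslashMk_mul_comul,
            LinearEquiv.coe_coe, TensorProduct.lid_tmul, TensorProduct.tmul_smul]
          rw [mul_smul_comm, map_smul, TensorProduct.smul_tmul']
    have h4 : (TensorProduct.lid k B).toLinearMap ∘ₗ (Coalgebra.counit (R := k)).rTensor B ∘ₗ
        Coalgebra.comul (R := k) (A := B) = LinearMap.id := by
      ext b
      simp
    have h5 : ∀ z : B ⊗[k] B, (TensorProduct.lid k B).toLinearMap.lTensor B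
        (((Coalgebra.counit (R := k) (A := B)).rTensor B).lTensor B
          ((Coalgebra.comul (R := k) (A := B)).lTensor B z)) = z := by
      intro z
      rw [← LinearMap.comp_apply, ← LinearMap.comp_apply, ← LinearMap.lTensor_comp,
        ← LinearMap.lTensor_comp, LinearMap.comp_assoc, h4, LinearMap.lTensor_id,
        LinearMap.id_apply]
    rw [copComul_comul, h, h5, oslashMk_mul_comul, TensorProduct.map_tmul,
      TensorProduct.smul_tmul']

lemma comul_aux (t : B ⊗[k] B) (b : B) :
    (TensorProduct.map (oslashMk k B) (oslashMk k B) ∘ₗ (copComul k B).toLinearMap)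
      (t * Coalgebra.comul (R := k) b) = Coalgebra.counit (R := k) b •
    (TensorProduct.map (oslashMk k B) (oslashMk k B) ∘ₗ (copComul k B).toLinearMap) t := by
  simp only [LinearMap.comp_apply, AlgHom.toLinearMap_apply, map_mul, map_oslashMk_mul_copComul]

lemma counit_aux (t : B ⊗[k] B) (b : B) : (Bialgebra.counitAlgHom k (B ⊗[k] B)).toLinearMap (t * Coalgebra.comul (R := k) b) = Coalgebra.counit (R := k) b • (Bialgebra.counitAlgHom k (B ⊗[k] B)).toLinearMap t := by
  have h : ∀ u : B ⊗[k] B, Coalgebra.counit (R := k) u = Coalgebra.counit (R := k)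
      (TensorProduct.lid k B ((Coalgebra.counit (R := k) (A := B)).rTensor B u)) := by
    intro u
    induction u with
    | zero => simp
    | add x y hx hy => simp only [map_add, hx, hy]
    | tmul x y => simp [mul_comm]
  simp only [AlgHom.toLinearMap_apply, map_mul, Bialgebra.counitAlgHom_apply]
  rw [h (Coalgebra.comul b), Coalgebra.rTensor_counit_comul, TensorProduct.lid_tmul, one_smul,
    smul_eq_mul, mul_comm]

lemma cop_aux1 (u : B ⊗[k] B) :
    TensorProduct.assoc k B B B (((TensorProduct.comm k B B).toLinearMap ∘ₗ
      Coalgebra.comul).rTensor B (TensorProduct.comm k B B u)) =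
    TensorProduct.assoc k B B B (TensorProduct.comm k B (B ⊗[k] B)
      ((TensorProduct.comm k B B).toLinearMap.lTensor B (Coalgebra.comul.lTensor B u))) := by
  induction u with
  | zero => simp
  | add x y hx hy => simp only [map_add, hx, hy]
  | tmul x y => simp

lemma cop_aux2 (u : B ⊗[k] B) :
    ((TensorProduct.comm k B B).toLinearMap ∘ₗ
      Coalgebra.comul).lTensor B (TensorProduct.comm k B B u) =
    TensorProduct.assoc k B B B (TensorProduct.comm k B (B ⊗[k] B)
      ((TensorProduct.comm k B B).toLinearMap.lTensor B
        (TensorProduct.assoc k B B B (Coalgebra.comul.rTensor B u)))) := by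
  induction u with
  | zero => simp
  | add x y hx hy => simp only [map_add, hx, hy]
  | tmul x y =>
    simp only [TensorProduct.comm_tmul, LinearMap.lTensor_tmul, LinearMap.rTensor_tmul,
      LinearMap.comp_apply]
    generalize Coalgebra.comul (R := k) x = v
    induction v with
    | zero => simp
    | add x y hx hy => simp only [map_add, TensorProduct.tmul_add, TensorProduct.add_tmul, hx, hy]
    | tmul x y => simp

lemma cop_aux3 (u : B ⊗[k] B) :
    (Coalgebra.counit (R := k) (A := B)).rTensor B (TensorProduct.comm k B B u) =
      TensorProduct.comm k B k (Coalgebra.counit.lTensor B u) := by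
  induction u with
  | zero => simp
  | add x y hx hy => simp only [map_add, hx, hy]
  | tmul x y => simp

lemma cop_aux4 (u : B ⊗[k] B) :
    (Coalgebra.counit (R := k) (A := B)).lTensor B (TensorProduct.comm k B B u) =
      TensorProduct.comm k k B (Coalgebra.counit.rTensor B u) := by
  induction u with
  | zero => simp
  | add x y hx hy => simp only [map_add, hx, hy]
  | tmul x y => simp

/-- The co-opposite coalgebra `B^cop`, on the same vector space as `B`. -/
abbrev copCoalgebra : Coalgebra k B where
  comul := (TensorProduct.comm k B B).toLinearMap ∘ₗ Coalgebra.comul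
  counit := Coalgebra.counit
  coassoc := by
    ext x
    have h1 := cop_aux1 (Coalgebra.comul (R := k) x)
    have h2 := cop_aux2 (Coalgebra.comul (R := k) x)
    rw [Coalgebra.coassoc_apply] at h2
    exact h1.trans h2.symm
  rTensor_counit_comp_comul := by
    ext x
    have h := cop_aux3 (Coalgebra.comul (R := k) x)
    rw [Coalgebra.lTensor_counit_comul] at h
    exact h
  lTensor_counit_comp_comul := by
    ext x
    have h := cop_aux4 (Coalgebra.comul (R := k) x)
    rw [Coalgebra.rTensor_counit_comul] at h
    exact h

/-- The tensor product coalgebra `B ⊗ B^cop`. -/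
abbrev copTensor : Coalgebra k (B ⊗[k] B) :=
  @TensorProduct.instCoalgebra k k B B _ _ _ _ _ _ _ _ _ copCoalgebra _

lemma isCoideal : @Submodule.IsCoideal k (B ⊗[k] B) _ _ _ copTensor.toCoalgebraStruct
    ((oslashIdeal k B).restrictScalars k) := by
  refine @Submodule.IsCoideal.mk k (B ⊗[k] B) _ _ _ copTensor.toCoalgebraStruct _ ?_ ?_
  · exact eq_zero_of_mem_oslashIdeal
      (Bialgebra.counitAlgHom k (B ⊗[k] B)).toLinearMap counit_aux
  · exact eq_zero_of_mem_oslashIdeal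
      (TensorProduct.map (oslashMk k B) (oslashMk k B) ∘ₗ (copComul k B).toLinearMap)
      comul_aux

/-- The quotient of a coalgebra by a coideal. -/
abbrev quotCoalgebra {C : Type u} [AddCommGroup C] [Module k C] [Coalgebra k C]
    (I : Submodule k C) [I.IsCoideal] : Coalgebra k (C ⧸ I) := inferInstance


/-- The comultiplication and counit of `B ⊘ B` are
`Δ(x ⊘ y) = (x₁ ⊘ y₂) ⊗ (x₂ ⊘ y₁)` and `ε(x ⊘ y) = ε(x) ε(y)`. -/
instance : CoalgebraStruct k (Oslash k B) where
  comul := oslashLift k B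
    (TensorProduct.map (oslashMk k B) (oslashMk k B) ∘ₗ (copComul k B).toLinearMap)
    (eq_zero_of_mem_oslashIdeal _ comul_aux)
  counit := oslashLift k B (Bialgebra.counitAlgHom k (B ⊗[k] B)).toLinearMap
    (eq_zero_of_mem_oslashIdeal _ counit_aux)

/-- The quotient coalgebra of `B ⊗ B^cop` by `(B ⊗ B) Δ(B⁺)`. -/
abbrev quotCop : Coalgebra k ((B ⊗[k] B) ⧸ (oslashIdeal k B).restrictScalars k) :=
  @quotCoalgebra k _ (B ⊗[k] B) _ _ copTensor _ isCoideal

instance : Coalgebra k (Oslash k B) where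
  coassoc := (quotCop (k := k) (B := B)).coassoc
  rTensor_counit_comp_comul := (quotCop (k := k) (B := B)).rTensor_counit_comp_comul
  lTensor_counit_comp_comul := (quotCop (k := k) (B := B)).lTensor_counit_comp_comul

lemma counit_oslash (x y : B) : Coalgebra.counit (R := k) (oslash k x y) =
    Coalgebra.counit (R := k) y • Coalgebra.counit (R := k) x := rfl

lemma comul_oslash (x y : B) : Coalgebra.comul (R := k) (oslash k x y) =
    TensorProduct.map (oslashMk k B) (oslashMk k B) (copComul k B (x ⊗ₜ[k] y)) := rfl

end Oslash

section Integrals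

/-- For a coalgebra `C` with a distinguished element `e`, the left integrals in the dual algebra
`C* = Hom(C, k)` (with the convolution product), augmented by `μ ↦ μ(e)`: the functionals `f` with
`μ * f = μ(e) f` for all `μ ∈ C*`. -/
def leftIntegrals (k : Type v) (C : Type u) [Field k] [AddCommGroup C] [Module k C]
    [CoalgebraStruct k C] (e : C) : Submodule k (Module.Dual k C) where
  carrier := {f | ∀ μ : Module.Dual k C,
    WithConv.toConv μ * WithConv.toConv f = μ e • WithConv.toConv f}
  add_mem' := by
    intro f g hf hg μ
    simp only [Set.mem_ofPred_eq] at hf hg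
    rw [WithConv.toConv_add, mul_add, hf, hg, smul_add]
  zero_mem' := by
    intro μ
    simp
  smul_mem' := by
    intro c f hf μ
    simp only [Set.mem_ofPred_eq] at hf
    rw [WithConv.toConv_smul, mul_smul_comm, hf, smul_comm]

/-- The left integrals `∫ₗ H*` on a Hopf algebra `H`: functionals `τ` with `μ * τ = μ(1) τ` for all
`μ ∈ H*`. -/
abbrev hopfLeftIntegrals (k : Type v) (H : Type u) [Field k] [Ring H] [HopfAlgebra k H] :
    Submodule k (Module.Dual k H) :=
  leftIntegrals k H 1

variable (k : Type v) (B : Type u) [Field k] [Ring B] [Bialgebra k B]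

/-- The usual left integrals `∫ₗ (B ⊘ B)*` in the dual algebra of the coalgebra `B ⊘ B`, augmented
by evaluation at `1 ⊘ 1`. -/
abbrev oslashLeftIntegrals : Submodule k (Module.Dual k (Oslash k B)) :=
  leftIntegrals k (Oslash k B) (oslash k (1 : B) (1 : B))

/-- The left integrals in the pre-dual `⋆B = (B ⊘ B)*`: the functionals `f` on `B ⊘ B` with
`x₁ f(x₂ ⊘ y) ⊘ 1 = f(x ⊘ y₁) y₂ ⊘ 1` for all `x, y ∈ B`. -/
def predualLeftIntegrals : Submodule k (Module.Dual k (Oslash k B)) where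
  carrier := {f | ∀ x y : B,
    iMap k B (TensorProduct.rid k B
        ((f ∘ₗ (oslash k).flip y).lTensor B (Coalgebra.comul (R := k) x)))
      = iMap k B (TensorProduct.lid k B
        ((f ∘ₗ oslash k x).rTensor B (Coalgebra.comul (R := k) y)))}
  add_mem' := by
    intro f g hf hg x y
    simp only [Set.mem_ofPred_eq] at hf hg
    simp only [LinearMap.add_comp, LinearMap.lTensor_add, LinearMap.rTensor_add,
      LinearMap.add_apply, map_add, hf, hg]
  zero_mem' := by
    intro x y
    simp
  smul_mem' := by
    intro c f hf x y
    simp only [Set.mem_ofPred_eq] at hf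
    simp only [LinearMap.smul_comp, LinearMap.lTensor_smul, LinearMap.rTensor_smul,
      LinearMap.smul_apply, map_smul, hf]

end Integrals

section HopfEnvelope

variable {k : Type v} {B H : Type u} [Field k] [Ring B] [Bialgebra k B]
  [Ring H] [HopfAlgebra k H]

/-- `q : B → H` exhibits the Hopf algebra `H` as the Hopf envelope `H(B)` of the bialgebra `B`:
every bialgebra map from `B` to a Hopf algebra factors uniquely through `q`. (Bialgebra maps
between Hopf algebras automatically commute with the antipodes.) -/
def IsHopfEnvelope (q : B →ₐc[k] H) : Prop :=
  ∀ (L : Type u) [Ring L] [HopfAlgebra k L] (g : B →ₐc[k] L),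
    ∃! h : H →ₐc[k] L, h.comp q = g

/-- The map `B ⊗ B → H`, `x ⊗ y ↦ f(x) S(f(y))`. -/
def preHat (f : B →ₐc[k] H) : (B ⊗[k] B) →ₗ[k] H :=
  LinearMap.mul' k H ∘ₗ
    TensorProduct.map (f : B →ₗ[k] H) (HopfAlgebra.antipode k ∘ₗ (f : B →ₗ[k] H))

lemma preHat_mul_comul (f : B →ₐc[k] H) (t : B ⊗[k] B) (b : B) :
    preHat f (t * Coalgebra.comul (R := k) b)
      = Coalgebra.counit (R := k) b • preHat f t := by
  induction t with
  | zero => simp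
  | add x y hx hy => rw [add_mul, map_add, map_add, hx, hy, smul_add]
  | tmul x y =>
    have h : ∀ u : B ⊗[k] B, preHat f ((x ⊗ₜ[k] y) * u) =
        f x * LinearMap.mul' k H ((HopfAlgebra.antipode k).lTensor H
          (TensorProduct.map (f : B →ₗ[k] H) (f : B →ₗ[k] H) u)) *
          HopfAlgebra.antipode k (f y) := by
      intro u
      induction u with
      | zero => simp
      | add x y hx hy => simp only [map_add, mul_add, add_mul, hx, hy]
      | tmul a c =>
        simp [preHat, HopfAlgebra.antipode_mul_antidistrib, mul_assoc]
    have h5 : TensorProduct.map (f : B →ₗ[k] H) (f : B →ₗ[k] H) (Coalgebra.comul (R := k) b)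
        = Coalgebra.comul (R := k) (f b) := CoalgHomClass.map_comp_comul_apply f b
    have h6 : Coalgebra.counit (R := k) (f b) = Coalgebra.counit (R := k) b :=
      CoalgHomClass.counit_comp_apply f b
    rw [h, h5, HopfAlgebra.mul_antipode_lTensor_comul_apply, h6, ← Algebra.commutes, mul_assoc,
      ← Algebra.smul_def]
    rfl

/-- The map `f̂ : B ⊘ B → H`, `x ⊘ y ↦ f(x) S(f(y))`, of a bialgebra map `f : B → H` into a Hopf
algebra with antipode `S`. -/
def hat (f : B →ₐc[k] H) : Oslash k B →ₗ[k] H :=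
  oslashLift k B (preHat f) (eq_zero_of_mem_oslashIdeal _ (preHat_mul_comul f))

lemma hat_oslash (f : B →ₐc[k] H) (x y : B) :
    hat f (oslash k x y) = f x * HopfAlgebra.antipode k (f y) := rfl

end HopfEnvelope

end BialgIntegral

end

/-!
The proof works with comatrices, that is, square matrices `A` over a coalgebra with
`Δ(aᵢⱼ) = ∑ₗ aᵢₗ ⊗ aₗⱼ` and `ε(aᵢⱼ) = δᵢⱼ`. Their entries span the coalgebra
(`exists_isComatrix`), so linear identities need only be checked on them, and no Sweedler sums are
needed.

*The kernel of `i_B`.* In `B ⊘ B` the relation `∑ₗ x aᵢₗ ⊘ y aₗⱼ = δᵢⱼ (x ⊘ y)` says that right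
multiplication by a comatrix is injective on rows modulo the left ideal `ker i_B`. If `B` is left
Artinian, the chain of left ideals generated by the powers of `A` stabilises, and cancelling gives
`S` with `S A ≡ 1` modulo `ker i_B` (`IsComatrix.exists_left_inverse`). Then
`x ⊘ aᵢⱼ = x sᵢⱼ ⊘ 1`, so `i_B` is onto (`iMap_surjective`). A surjective endomorphism of the module
`(B / ker i_B)ⁿ` of finite length is injective, which makes `ker i_B` two-sided
(`kerIdeal_isTwoSided`); it is a coideal because `i_B` is a coalgebra map. In `B / ker i_B` every
comatrix is invertible, and its inverse defines an antipode (`quotHopfAlgebra`). A bialgebra map `g`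
to a Hopf algebra satisfies `ĝ ∘ i_B = g`, hence factors through `B / ker i_B`, which is therefore
the Hopf envelope (`isHopfEnvelope_quotMap`).

*Finiteness.* An Artinian algebra with an augmentation has an idempotent `e ≠ 0` that annihilates
every simple module other than the trivial one and has rank at most one on that; so `e` has
finite-dimensional image on modules of finite length, and `e H` is a finite-dimensional right
ideal (`exists_finiteDimensional_right_ideal`). In a Hopf algebra the subcomodule that a right ideal
generates is again a right ideal, and a nonzero right ideal that is a subcomodule is everything, as
`x₁ S(x₂) = ε(x) 1`. So an Artinian Hopf algebra is finite-dimensional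
(`finiteDimensional_of_isArtinianRing`).

*Integrals.* The dual of a finite-dimensional Hopf algebra `H` is a Hopf module, with left integrals
as its coinvariants. The projection `m ↦ m₀ S(m₁)` onto them recovers every `m`, so a nonzero
integral exists (`exists_ne_zero_mem_hopfLeftIntegrals`); and `h ↦ τ(– S(h))` is injective for a
nonzero integral `τ`, hence onto `H*`, from which uniqueness follows (`hopfLeftIntegrals_eq_span`).

*Transport.* For the Hopf envelope `q`, the map `q̂` is bijective, and `q̂ ∘ i_B = q`, so integrals
on `H(B)` and on the coalgebra `B ⊘ B` correspond (`comp_hat_mem_iff`). Putting `y = 1` in the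
condition for an integral of the pre-dual gives a usual integral; the converse follows from
`x₁ S(y₂) f(x₂ ⊘ y₁) = f(x ⊘ y) 1` in `H(B)` (`predualLeftIntegrals_eq`).
-/

noncomputable section

namespace BialgIntegral

/-! ### Slices of tensors -/

section Slices

variable {k M N : Type*} [Field k] [AddCommGroup M] [Module k M] [AddCommGroup N] [Module k N]

/-- Evaluation of a functional in the right tensor factor: `m ⊗ n ↦ φ(n) m`. -/
def sliceRight (φ : Module.Dual k N) : M ⊗[k] N →ₗ[k] M :=
  (TensorProduct.rid k M).toLinearMap ∘ₗ φ.lTensor M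

/-- Evaluation of a functional in the left tensor factor: `m ⊗ n ↦ φ(m) n`. -/
def sliceLeft (φ : Module.Dual k M) : M ⊗[k] N →ₗ[k] N :=
  (TensorProduct.lid k N).toLinearMap ∘ₗ φ.rTensor N

@[simp] lemma sliceRight_tmul (φ : Module.Dual k N) (m : M) (n : N) :
    sliceRight φ (m ⊗ₜ[k] n) = φ n • m := by simp [sliceRight]

@[simp] lemma sliceLeft_tmul (φ : Module.Dual k M) (m : M) (n : N) :
    sliceLeft φ (m ⊗ₜ[k] n) = φ m • n := by simp [sliceLeft]

/-- Expansion of a tensor along a basis of its right factor. -/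
lemma exists_eq_sum_sliceRight (z : M ⊗[k] N) :
    ∃ (s : Finset (Module.Basis.ofVectorSpaceIndex k N)),
      z = ∑ i ∈ s, sliceRight ((Module.Basis.ofVectorSpace k N).coord i) z ⊗ₜ[k]
        Module.Basis.ofVectorSpace k N i := by
  classical
  set b := Module.Basis.ofVectorSpace k N
  have key : ∀ z : M ⊗[k] N, ∀ i, TensorProduct.equivFinsuppOfBasisRight b z i
      = sliceRight (b.coord i) z := by
    intro z i
    induction z with
    | zero => simp
    | add x y hx hy => simp [hx, hy]
    | tmul x y => simp
  refine ⟨(TensorProduct.equivFinsuppOfBasisRight b z).support, ?_⟩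
  conv_lhs => rw [← (TensorProduct.equivFinsuppOfBasisRight b).symm_apply_apply z,
    TensorProduct.equivFinsuppOfBasisRight_symm_apply, Finsupp.sum]
  exact Finset.sum_congr rfl fun i _ => by rw [key]

/-- The functionals on the right factor separate the points of a tensor product. -/
lemma eq_of_sliceRight_eq {z w : M ⊗[k] N}
    (h : ∀ φ : Module.Dual k N, sliceRight φ z = sliceRight φ w) : z = w := by
  rw [← sub_eq_zero]
  obtain ⟨s, hs⟩ := exists_eq_sum_sliceRight (z - w)
  rw [hs]
  exact Finset.sum_eq_zero fun i _ => by rw [map_sub, h, sub_self, TensorProduct.zero_tmul]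

lemma sliceRight_comm (φ : Module.Dual k M) (z : M ⊗[k] N) :
    sliceRight φ (TensorProduct.comm k M N z) = sliceLeft φ z := by
  induction z with
  | zero => simp
  | add x y hx hy => simp [hx, hy]
  | tmul x y => simp

lemma eq_of_sliceLeft_eq {z w : M ⊗[k] N}
    (h : ∀ φ : Module.Dual k M, sliceLeft φ z = sliceLeft φ w) : z = w := by
  apply (TensorProduct.comm k M N).injective
  exact eq_of_sliceRight_eq fun φ => by rw [sliceRight_comm, sliceRight_comm, h]

lemma apply_sliceRight (ψ : Module.Dual k M) (φ : Module.Dual k N) (z : M ⊗[k] N) :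
    ψ (sliceRight φ z) = φ (sliceLeft ψ z) := by
  induction z with
  | zero => simp
  | add x y hx hy => simp [hx, hy]
  | tmul x y => simp [mul_comm]

/-- The slices of a single tensor span a finite-dimensional space. -/
lemma exists_finiteDimensional_sliceRight (z : M ⊗[k] N) :
    ∃ W : Submodule k M, FiniteDimensional k W ∧ ∀ φ : Module.Dual k N, sliceRight φ z ∈ W := by
  classical
  induction z with
  | zero => exact ⟨⊥, inferInstance, fun φ => by simp⟩
  | add x y hx hy =>
    obtain ⟨W₁, h₁, h₁'⟩ := hx
    obtain ⟨W₂, h₂, h₂'⟩ := hy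
    refine ⟨W₁ ⊔ W₂, inferInstance, fun φ => ?_⟩
    rw [map_add]
    exact Submodule.add_mem_sup (h₁' φ) (h₂' φ)
  | tmul x y =>
    refine ⟨k ∙ x, inferInstance, fun φ => ?_⟩
    rw [sliceRight_tmul]
    exact Submodule.smul_mem _ _ (Submodule.mem_span_singleton_self x)

lemma exists_finiteDimensional_sliceLeft (z : M ⊗[k] N) :
    ∃ W : Submodule k N, FiniteDimensional k W ∧ ∀ φ : Module.Dual k M, sliceLeft φ z ∈ W := by
  obtain ⟨W, hW, h⟩ := exists_finiteDimensional_sliceRight (TensorProduct.comm k M N z)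
  exact ⟨W, hW, fun φ => by rw [← sliceRight_comm]; exact h φ⟩

end Slices

/-! ### Comatrices and the fundamental theorem of coalgebras -/

section Comatrix

/-- A square matrix `A = (aᵢⱼ)` over a coalgebra is a comatrix (a matrix of coefficients of a
finite-dimensional comodule) if `Δ(aᵢⱼ) = ∑ₗ aᵢₗ ⊗ aₗⱼ` and `ε(aᵢⱼ) = δᵢⱼ`. -/
structure IsComatrix (k : Type*) {C : Type*} [Field k] [AddCommGroup C] [Module k C]
    [Coalgebra k C] {n : ℕ} (A : Matrix (Fin n) (Fin n) C) : Prop where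
  comul_apply : ∀ i j, Coalgebra.comul (R := k) (A i j) = ∑ l, A i l ⊗ₜ[k] A l j
  counit_apply : ∀ i j, Coalgebra.counit (R := k) (A i j) = if i = j then 1 else 0

variable {k C : Type*} [Field k] [AddCommGroup C] [Module k C] [Coalgebra k C]

lemma sliceLeft_counit_comul (c : C) :
    sliceLeft (Coalgebra.counit (R := k)) (Coalgebra.comul (R := k) c) = c := by
  simp [sliceLeft]

lemma sliceRight_counit_comul (c : C) :
    sliceRight (Coalgebra.counit (R := k)) (Coalgebra.comul (R := k) c) = c := by
  simp [sliceRight]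

lemma sliceLeft_comul_sliceLeft_comul (φ ψ : Module.Dual k C) (c : C) :
    sliceLeft φ (Coalgebra.comul (R := k) (sliceLeft ψ (Coalgebra.comul (R := k) c))) =
      sliceLeft (φ ∘ₗ sliceLeft ψ ∘ₗ Coalgebra.comul) (Coalgebra.comul (R := k) c) := by
  have h1 : ∀ z : C ⊗[k] C, sliceLeft φ (Coalgebra.comul (R := k) (sliceLeft ψ z)) =
      sliceLeft φ (sliceLeft ψ (Coalgebra.comul.lTensor C z)) := by
    intro z
    induction z with
    | zero => simp
    | add x y hx hy => simp only [map_add, hx, hy]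
    | tmul x y => simp
  have h2 : ∀ z : C ⊗[k] C, sliceLeft φ (sliceLeft ψ (TensorProduct.assoc k C C C
      (Coalgebra.comul.rTensor C z))) = sliceLeft (φ ∘ₗ sliceLeft ψ ∘ₗ Coalgebra.comul) z := by
    intro z
    induction z with
    | zero => simp
    | add x y hx hy => simp only [map_add, hx, hy]
    | tmul x y =>
      simp only [LinearMap.rTensor_tmul, sliceLeft_tmul, LinearMap.comp_apply]
      generalize Coalgebra.comul (R := k) x = w
      induction w with
      | zero => simp
      | add x y hx hy => simp only [map_add, TensorProduct.add_tmul, hx, hy, add_smul]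
      | tmul x y => simp [mul_smul]
  rw [h1, ← Coalgebra.coassoc_apply, h2]

/-- The fundamental theorem of coalgebras, in matrix form: every element of a coalgebra is a
linear combination of the entries of a comatrix. -/
theorem exists_isComatrix (c : C) : ∃ (n : ℕ) (A : Matrix (Fin n) (Fin n) C) (r s : Fin n → k),
    IsComatrix k A ∧ c = ∑ i, ∑ j, (r i * s j) • A i j := by
  classical
  -- the left subcomodule generated by `c`
  let V : Submodule k C := LinearMap.range
    ({ toFun := fun φ => sliceLeft φ (Coalgebra.comul (R := k) c)
       map_add' := fun φ ψ => by simp [sliceLeft, LinearMap.rTensor_add]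
       map_smul' := fun t φ => by simp [sliceLeft, LinearMap.rTensor_smul] } :
      Module.Dual k C →ₗ[k] C)
  have hVmem : ∀ φ, sliceLeft φ (Coalgebra.comul (R := k) c) ∈ V := fun φ => ⟨φ, rfl⟩
  have hVfin : FiniteDimensional k V := by
    obtain ⟨W, hW, h⟩ := exists_finiteDimensional_sliceLeft (Coalgebra.comul (R := k) c)
    exact Submodule.finiteDimensional_of_le (S₂ := W) (by rintro _ ⟨φ, rfl⟩; exact h φ)
  have hVcomul : ∀ w ∈ V, ∀ φ, sliceLeft φ (Coalgebra.comul (R := k) w) ∈ V := by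
    rintro _ ⟨ψ, rfl⟩ φ
    exact ⟨_, (sliceLeft_comul_sliceLeft_comul φ ψ c).symm⟩
  let n := Module.finrank k V
  let b : Module.Basis (Fin n) k V := Module.finBasis k V
  obtain ⟨p, hp⟩ := V.subtype.exists_leftInverse_of_injective V.ker_subtype
  let d : Fin n → Module.Dual k C := fun j => b.coord j ∘ₗ p
  have hpV : ∀ w : V, p w = w := fun w => DFunLike.congr_fun hp w
  have hd : ∀ w ∈ V, w = ∑ j, d j w • (b j : C) := by
    intro w hw
    have h1 : ((∑ j, b.repr ⟨w, hw⟩ j • b j : V) : C) = w :=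
      congrArg Subtype.val (b.sum_repr ⟨w, hw⟩)
    have h2 : p w = ⟨w, hw⟩ := hpV ⟨w, hw⟩
    rw [Submodule.coe_sum] at h1
    refine h1.symm.trans (Finset.sum_congr rfl fun j _ => ?_)
    simp [d, h2]
  have hdb : ∀ i j, d j (b i : C) = if i = j then 1 else 0 := by
    intro i j
    simp [d, hpV, Finsupp.single_apply]
  let A : Matrix (Fin n) (Fin n) C := fun i j =>
    sliceRight (d j) (Coalgebra.comul (R := k) (b i : C))
  have hA : ∀ i, Coalgebra.comul (R := k) (b i : C) = ∑ j, A i j ⊗ₜ[k] (b j : C) := by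
    intro i
    refine eq_of_sliceLeft_eq fun φ => ?_
    rw [map_sum, hd _ (hVcomul _ (b i).2 φ)]
    exact Finset.sum_congr rfl fun j _ => by rw [sliceLeft_tmul, apply_sliceRight]
  have hbA : ∀ i, (b i : C) = ∑ j, Coalgebra.counit (R := k) (b j : C) • A i j := by
    intro i
    conv_lhs => rw [← sliceRight_counit_comul (k := k) (b i : C), hA i, map_sum]
    simp
  refine ⟨n, A, fun i => d i c, fun j => Coalgebra.counit (R := k) (b j : C), ⟨?_, ?_⟩, ?_⟩
  · intro i j
    have h1 := Coalgebra.coassoc_apply (R := k) (b i : C)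
    rw [hA i] at h1
    simp only [map_sum, LinearMap.rTensor_tmul, LinearMap.lTensor_tmul, hA,
      TensorProduct.tmul_sum] at h1
    have h2 := congrArg (fun z => sliceRight (d j) ((TensorProduct.assoc k C C C).symm z)) h1
    simpa [hdb] using h2
  · intro i j
    have h1 := sliceLeft_counit_comul (k := k) (b i : C)
    rw [hA i] at h1
    have h2 := congrArg (d j) h1
    simpa [hdb] using h2
  · have hc : c ∈ V := by
      have := hVmem (Coalgebra.counit (R := k))
      rwa [sliceLeft_counit_comul] at this
    conv_lhs => rw [hd c hc]
    refine Finset.sum_congr rfl fun i _ => ?_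
    rw [hbA i, Finset.smul_sum]
    exact Finset.sum_congr rfl fun j _ => (mul_smul _ _ _).symm

/-- A linear map on a coalgebra is determined by its values on the entries of comatrices. -/
lemma linearMap_ext_of_isComatrix {M : Type*} [AddCommGroup M] [Module k M] {f g : C →ₗ[k] M}
    (h : ∀ (n : ℕ) (A : Matrix (Fin n) (Fin n) C), IsComatrix k A → ∀ i j, f (A i j) = g (A i j)) :
    f = g := by
  ext c
  obtain ⟨n, A, r, s, hA, rfl⟩ := exists_isComatrix (k := k) c
  simp [map_sum, h n A hA]

end Comatrix

/-! ### Comatrices and right ideals in Hopf algebras -/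

section HopfComatrix

variable {k H : Type*} [Field k] [Ring H] [HopfAlgebra k H]

/-- Over a Hopf algebra, the matrix `S(A)` is the inverse of a comatrix `A`. -/
lemma IsComatrix.antipode_mul {n : ℕ} {A : Matrix (Fin n) (Fin n) H} (hA : IsComatrix k A)
    (i j : Fin n) :
    ∑ l, HopfAlgebra.antipode k (A i l) * A l j = if i = j then 1 else 0 := by
  have h := HopfAlgebra.mul_antipode_rTensor_comul_apply (R := k) (A i j)
  rw [hA.comul_apply, hA.counit_apply] at h
  simpa [apply_ite] using h

lemma IsComatrix.mul_antipode {n : ℕ} {A : Matrix (Fin n) (Fin n) H} (hA : IsComatrix k A)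
    (i j : Fin n) :
    ∑ l, A i l * HopfAlgebra.antipode k (A l j) = if i = j then 1 else 0 := by
  have h := HopfAlgebra.mul_antipode_lTensor_comul_apply (R := k) (A i j)
  rw [hA.comul_apply, hA.counit_apply] at h
  simpa [apply_ite] using h

/-- A nonzero right ideal of a Hopf algebra that is a right subcomodule contains `1`: if `x` lies
in it, then so does `x₁ S(x₂) = ε(x) 1`, and the counit cannot vanish on it. -/
theorem one_mem_of_right_ideal_subcomodule (N : Submodule k H)
    (hmul : ∀ x ∈ N, ∀ h : H, x * h ∈ N)
    (hcomul : ∀ x ∈ N, ∀ φ : Module.Dual k H,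
      sliceRight φ (Coalgebra.comul (R := k) x) ∈ N)
    (hN : N ≠ ⊥) : (1 : H) ∈ N := by
  obtain ⟨x, hx, hx0⟩ := N.ne_bot_iff.1 hN
  obtain ⟨φ, hφ⟩ : ∃ φ : Module.Dual k H, φ x ≠ 0 := by
    by_contra! h
    exact hx0 ((Module.forall_dual_apply_eq_zero_iff k x).1 h)
  set y := sliceRight φ (Coalgebra.comul (R := k) x) with hy
  have hyN : y ∈ N := hcomul x hx φ
  have hy0 : Coalgebra.counit (R := k) y ≠ 0 := by
    rwa [hy, apply_sliceRight, sliceLeft_counit_comul]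
  have h1 := HopfAlgebra.mul_antipode_lTensor_comul_apply (R := k) y
  obtain ⟨s, hs⟩ := exists_eq_sum_sliceRight (Coalgebra.comul (R := k) y)
  rw [hs, map_sum, map_sum] at h1
  have h2 : algebraMap k H (Coalgebra.counit (R := k) y) ∈ N := by
    rw [← h1]
    refine N.sum_mem fun i _ => ?_
    rw [LinearMap.lTensor_tmul, LinearMap.mul'_apply]
    exact hmul _ (hcomul _ hyN _) _
  rw [Algebra.algebraMap_eq_smul_one] at h2
  exact (N.smul_mem_iff hy0).1 h2

end HopfComatrix

/-! ### Idempotents acting on modules of finite length -/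

section FiniteLength

variable {k R : Type*} [Field k] [Ring R] [Algebra k R]

/-- If an idempotent `e` has finite-dimensional image on every simple module, then it has
finite-dimensional image on every module of finite length. -/
lemma exists_finiteDimensional_idempotent_smul {e : R} (he : IsIdempotentElem e)
    (hs : ∀ (X : Type u) [AddCommGroup X] [Module R X] [Module k X] [IsScalarTower k R X],
      IsSimpleModule R X → ∃ W : Submodule k X, FiniteDimensional k W ∧ ∀ x : X, e • x ∈ W)
    {X : Type u} [AddCommGroup X] [Module R X] (hX : IsFiniteLength R X) :
    ∀ [Module k X] [IsScalarTower k R X],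
      ∃ W : Submodule k X, FiniteDimensional k W ∧ ∀ x : X, e • x ∈ W := by
  induction hX with
  | of_subsingleton =>
    intro _ _
    exact ⟨⊥, inferInstance, fun x => by simp [Subsingleton.elim (e • x) 0]⟩
  | @of_simple_quotient M _ _ N hsimple hN ih =>
    intro _ _
    obtain ⟨W₁, h₁, h₁'⟩ := ih
    obtain ⟨W₂, h₂, h₂'⟩ := hs (M ⧸ N) hsimple
    let E : M →ₗ[k] M := Algebra.lsmul k k M e
    let π : M →ₗ[k] M ⧸ N := N.mkQ.restrictScalars k
    refine ⟨LinearMap.range E, ?_, fun x => ⟨x, rfl⟩⟩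
    refine Module.Finite.iff_fg.2 (Submodule.fg_of_fg_map_of_fg_inf_ker π ?_ ?_)
    · have : (LinearMap.range E).map π ≤ W₂ := by
        rintro _ ⟨_, ⟨x, rfl⟩, rfl⟩
        exact h₂' (N.mkQ x)
      exact Module.Finite.iff_fg.1 (Submodule.finiteDimensional_of_le this)
    · have : LinearMap.range E ⊓ LinearMap.ker π ≤
          W₁.map (N.subtype.restrictScalars k) := by
        rintro _ ⟨⟨x, rfl⟩, hx⟩
        have hxN : e • x ∈ N := (Submodule.Quotient.mk_eq_zero N).1 hx
        refine ⟨e • ⟨e • x, hxN⟩, h₁' _, ?_⟩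
        -- an element of `eM` that lies in `N` is fixed by `e`, so it lies in `eN`
        change e • e • x = e • x
        rw [← mul_smul, he.eq]
      exact Module.Finite.iff_fg.1 (Submodule.finiteDimensional_of_le this)

end FiniteLength

/-! ### Artinian Hopf algebras are finite-dimensional -/

section Artinian

variable {k : Type v} {H : Type u} [Field k] [Ring H] [HopfAlgebra k H]

/-- In an Artinian augmented algebra there is a nonzero idempotent `e` such that `x e` lies in the
Jacobson radical for all `x` with `ε(x) = 0`: modulo the radical, `e` generates a complement of the
augmentation ideal. -/
lemma exists_idempotent_mul_mem_jacobson [IsArtinianRing H] (ε : H →ₐ[k] k) :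
    ∃ e : H, IsIdempotentElem e ∧ e ≠ 0 ∧ ∀ x, ε x = 0 → x * e ∈ Ring.jacobson H := by
  let J := Ring.jacobson H
  let π : H →+* H ⧸ J := Ideal.Quotient.mk J
  have hnil : IsNilpotent J := IsSemiprimaryRing.isNilpotent
  have hker : ∀ x ∈ RingHom.ker π, IsNilpotent x := by
    intro x hx
    rw [Ideal.mk_ker] at hx
    obtain ⟨n, hn⟩ := hnil
    refine ⟨n, ?_⟩
    have := Ideal.pow_mem_pow hx n
    rwa [hn] at this
  let m : Ideal H := RingHom.ker ε.toRingHom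
  have hJm : J ≤ m := by
    intro x hx
    -- an element of the radical is nilpotent, and `k` is reduced
    have := (hker x (by rwa [Ideal.mk_ker])).map ε
    exact this.eq_zero
  obtain ⟨u, hu, hmu⟩ := IsSemisimpleRing.ideal_eq_span_idempotent (m.map π)
  obtain ⟨e, he, heu⟩ := exists_isIdempotentElem_eq_of_ker_isNilpotent π hker (1 - u)
    (Ideal.Quotient.mk_surjective _) hu.one_sub
  have hmem : ∀ x, ε x = 0 → x * e ∈ J := by
    intro x hx
    have h1 : π x ∈ m.map π := Ideal.mem_map_of_mem π hx
    rw [hmu, Ideal.mem_span_singleton'] at h1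
    obtain ⟨y, hy⟩ := h1
    rw [← Ideal.Quotient.eq_zero_iff_mem, map_mul]
    change π x * π e = 0
    rw [heu, ← hy, mul_assoc, mul_sub, mul_one, hu.eq, sub_self, mul_zero]
  refine ⟨e, he, ?_, hmem⟩
  rintro rfl
  have hu1 : u = 1 := by rw [map_zero] at heu; exact (sub_eq_zero.1 heu.symm).symm
  rw [hu1, Ideal.span_singleton_one] at hmu
  have h1 : (1 : H ⧸ J) ∈ m.map π := hmu ▸ Submodule.mem_top
  rw [Ideal.mem_map_iff_of_surjective π Ideal.Quotient.mk_surjective] at h1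
  obtain ⟨x, hx, hx1⟩ := h1
  have h2 : x - 1 ∈ J := by
    rw [← Ideal.Quotient.eq_zero_iff_mem, map_sub, map_one]
    exact sub_eq_zero.2 hx1
  have h3 : ε (x - 1) = 0 := hJm h2
  have h4 : ε x = 0 := hx
  simp [h4] at h3

/-- An Artinian augmented algebra has a nonzero finite-dimensional right ideal, namely `e H` for
an idempotent `e` lifting the trivial module: `e` maps any simple module onto a space of dimension
at most one, and `H` has finite length as a left module. -/
lemma exists_finiteDimensional_right_ideal [IsArtinianRing H] (ε : H →ₐ[k] k) :
    ∃ I : Submodule k H, FiniteDimensional k I ∧ I ≠ ⊥ ∧ ∀ x ∈ I, ∀ h, x * h ∈ I := by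
  obtain ⟨e, he, he0, hJ⟩ := exists_idempotent_mul_mem_jacobson ε
  have hfl : IsFiniteLength H H :=
    isFiniteLength_iff_isNoetherian_isArtinian.2 ⟨inferInstance, inferInstance⟩
  obtain ⟨W, hW, h⟩ := exists_finiteDimensional_idempotent_smul (k := k) he (by
    intro X _ _ _ _ hX
    by_cases hz : ∀ x : X, e • x = 0
    · exact ⟨⊥, inferInstance, fun x => by simp [hz x]⟩
    push Not at hz
    obtain ⟨x, hx⟩ := hz
    have hkill : ∀ (a : H) (y : X), ε a = 0 → a • e • y = 0 := by
      intro a y ha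
      rw [← mul_smul]
      have h1 := IsSemisimpleModule.jacobson_le_annihilator H X (hJ a ha)
      exact Module.mem_annihilator.1 h1 y
    refine ⟨k ∙ (e • x), inferInstance, fun y => ?_⟩
    have htop := IsSimpleModule.span_singleton_eq_top H hx
    have hy : e • y ∈ Submodule.span H {e • x} := htop ▸ Submodule.mem_top
    obtain ⟨a, ha⟩ := Submodule.mem_span_singleton.1 hy
    rw [← ha, Submodule.mem_span_singleton]
    refine ⟨ε a, ?_⟩
    have h2 := hkill (a - algebraMap k H (ε a)) x (by simp)
    rw [sub_smul, sub_eq_zero, algebraMap_smul] at h2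
    exact h2.symm) hfl
  let I : Submodule k H := LinearMap.range (LinearMap.mulLeft k e)
  refine ⟨I, Submodule.finiteDimensional_of_le (S₂ := W) ?_, ?_, ?_⟩
  · rintro _ ⟨x, rfl⟩
    exact h x
  · intro hI
    have : e ∈ I := ⟨e, he.eq⟩
    rw [hI] at this
    exact he0 this
  · rintro _ ⟨x, rfl⟩ h
    exact ⟨x * h, by simp [mul_assoc]⟩

lemma sliceRight_mul_tmul_one {A : Type*} [Ring A] [Algebra k A] (φ : Module.Dual k A)
    (z : A ⊗[k] A) (a : A) : sliceRight φ (z * (a ⊗ₜ[k] 1)) = sliceRight φ z * a := by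
  induction z with
  | zero => simp
  | add x y hx hy => simp [add_mul, hx, hy]
  | tmul x y => simp

lemma sliceRight_mul_one_tmul {A : Type*} [Ring A] [Algebra k A] (φ : Module.Dual k A)
    (z : A ⊗[k] A) (a : A) :
    sliceRight φ (z * (1 ⊗ₜ[k] a)) = sliceRight (φ ∘ₗ LinearMap.mulRight k a) z := by
  induction z with
  | zero => simp
  | add x y hx hy => simp [add_mul, hx, hy]
  | tmul x y => simp

/-- The identity `h ⊗ 1 = Δ(h₁) (1 ⊗ S(h₂))` for the entries of a comatrix. -/
lemma IsComatrix.tmul_one_eq_sum {n : ℕ} {A : Matrix (Fin n) (Fin n) H} (hA : IsComatrix k A)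
    (i j : Fin n) : A i j ⊗ₜ[k] (1 : H) =
      ∑ l, Coalgebra.comul (R := k) (A i l) * (1 ⊗ₜ[k] HopfAlgebra.antipode k (A l j)) := by
  simp_rw [hA.comul_apply, Finset.sum_mul, Algebra.TensorProduct.tmul_mul_tmul, mul_one]
  rw [Finset.sum_comm]
  simp_rw [← TensorProduct.tmul_sum, hA.mul_antipode, TensorProduct.tmul_ite]
  simp

/-- The subcomodule generated by a right ideal of a Hopf algebra is a right ideal. -/
lemma mul_mem_span_sliceRight {I : Submodule k H} (hI : ∀ x ∈ I, ∀ h, x * h ∈ I) {N : Submodule k H}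
    (hN : ∀ x ∈ I, ∀ φ : Module.Dual k H, sliceRight φ (Coalgebra.comul (R := k) x) ∈ N)
    {x : H} (hx : x ∈ I) (φ : Module.Dual k H) (h : H) :
    sliceRight φ (Coalgebra.comul (R := k) x) * h ∈ N := by
  obtain ⟨n, A, r, s, hA, rfl⟩ := exists_isComatrix (k := k) h
  simp_rw [Finset.mul_sum, mul_smul_comm]
  refine N.sum_mem fun i _ => N.sum_mem fun j _ => N.smul_mem _ ?_
  rw [← sliceRight_mul_tmul_one, hA.tmul_one_eq_sum, Finset.mul_sum, map_sum]
  refine N.sum_mem fun l _ => ?_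
  rw [← mul_assoc, ← Bialgebra.comul_mul, sliceRight_mul_one_tmul]
  exact hN _ (hI x hx _) _

lemma sliceRight_comul_sliceRight_comul {C : Type*} [AddCommGroup C] [Module k C] [Coalgebra k C]
    (φ ψ : Module.Dual k C) (c : C) :
    sliceRight φ (Coalgebra.comul (R := k) (sliceRight ψ (Coalgebra.comul (R := k) c))) =
      sliceRight (ψ ∘ₗ sliceLeft φ ∘ₗ Coalgebra.comul) (Coalgebra.comul (R := k) c) := by
  refine (DFunLike.congr_fun (f := sliceRight φ ∘ₗ Coalgebra.comul ∘ₗ sliceRight ψ ∘ₗ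
    Coalgebra.comul) (g := sliceRight (ψ ∘ₗ sliceLeft φ ∘ₗ Coalgebra.comul) ∘ₗ Coalgebra.comul)
    (linearMap_ext_of_isComatrix fun n A hA i j => ?_) c)
  simp only [LinearMap.comp_apply, hA.comul_apply, map_sum, sliceRight_tmul, map_smul,
    Finset.smul_sum, sliceLeft_tmul, Finset.sum_smul, smul_eq_mul, mul_smul]
  rw [Finset.sum_comm]
  exact Finset.sum_congr rfl fun _ _ => Finset.sum_congr rfl fun _ _ => smul_comm _ _ _

/-- An Artinian Hopf algebra is finite-dimensional: the subcomodule generated by a nonzero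
finite-dimensional right ideal is finite-dimensional and is the whole algebra. -/
theorem finiteDimensional_of_isArtinianRing [IsArtinianRing H] : FiniteDimensional k H := by
  obtain ⟨I, hI, hI0, hmul⟩ := exists_finiteDimensional_right_ideal (Bialgebra.counitAlgHom k H)
  let N : Submodule k H := Submodule.span k
    {y | ∃ x ∈ I, ∃ φ : Module.Dual k H, sliceRight φ (Coalgebra.comul (R := k) x) = y}
  have hN : ∀ x ∈ I, ∀ φ : Module.Dual k H, sliceRight φ (Coalgebra.comul (R := k) x) ∈ N :=
    fun x hx φ => Submodule.subset_span ⟨x, hx, φ, rfl⟩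
  have hNmul : ∀ y ∈ N, ∀ h : H, y * h ∈ N := by
    intro y hy h
    induction hy using Submodule.span_induction with
    | mem y hy =>
      obtain ⟨x, hx, φ, rfl⟩ := hy
      exact mul_mem_span_sliceRight hmul hN hx φ h
    | zero => simp
    | add a b _ _ ha hb => rw [add_mul]; exact N.add_mem ha hb
    | smul t a _ ha => rw [smul_mul_assoc]; exact N.smul_mem _ ha
  have hNcomul : ∀ y ∈ N, ∀ φ : Module.Dual k H,
      sliceRight φ (Coalgebra.comul (R := k) y) ∈ N := by
    intro y hy φ
    induction hy using Submodule.span_induction with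
    | mem y hy =>
      obtain ⟨x, hx, ψ, rfl⟩ := hy
      rw [sliceRight_comul_sliceRight_comul]
      exact hN x hx _
    | zero => simp
    | add a b _ _ ha hb => rw [map_add, map_add]; exact N.add_mem ha hb
    | smul t a _ ha => rw [map_smul, map_smul]; exact N.smul_mem _ ha
  have hN0 : N ≠ ⊥ := by
    obtain ⟨x, hx, hx0⟩ := I.ne_bot_iff.1 hI0
    refine N.ne_bot_iff.2 ⟨x, ?_, hx0⟩
    have := hN x hx (Coalgebra.counit (R := k))
    rwa [sliceRight_counit_comul] at this
  have h1 : (1 : H) ∈ N := one_mem_of_right_ideal_subcomodule N hNmul hNcomul hN0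
  have htop : N = ⊤ := by
    refine (Submodule.eq_top_iff').2 fun h => ?_
    have := hNmul 1 h1 h
    rwa [one_mul] at this
  -- `N` is contained in the sum of the slices of a finite basis of `I`
  choose W hWfin hW using fun x : H =>
    exists_finiteDimensional_sliceRight (Coalgebra.comul (R := k) x)
  let b := Module.finBasis k I
  have hle : N ≤ ⨆ i, W (b i : H) := by
    refine Submodule.span_le.2 ?_
    rintro _ ⟨x, hx, φ, rfl⟩
    have hxb : ((∑ j, b.repr ⟨x, hx⟩ j • b j : I) : H) = x :=
      congrArg Subtype.val (b.sum_repr ⟨x, hx⟩)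
    rw [← hxb, Submodule.coe_sum, map_sum, map_sum]
    refine Submodule.sum_mem _ fun j _ => ?_
    rw [Submodule.coe_smul, map_smul, map_smul]
    exact Submodule.smul_mem _ _ (Submodule.mem_iSup_of_mem j (hW _ φ))
  have : FiniteDimensional k (⊤ : Submodule k H) :=
    htop ▸ Submodule.finiteDimensional_of_le hle
  exact Module.finite_def.2 (Module.Finite.iff_fg.1 this)

end Artinian

/-! ### The kernel of `i_B` for an Artinian bialgebra -/

section Kernel

variable (k : Type v) (B : Type u) [Field k] [Ring B] [Bialgebra k B]

variable {k B} in
lemma oslashMk_mul_eq_zero {t : B ⊗[k] B} (ht : oslashMk k B t = 0) (s : B ⊗[k] B) :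
    oslashMk k B (s * t) = 0 := by
  have h1 : t ∈ oslashIdeal k B := (Submodule.Quotient.mk_eq_zero _).1 ht
  exact (Submodule.Quotient.mk_eq_zero _).2 (Ideal.mul_mem_left _ s h1)

/-- The kernel of `i_B : x ↦ x ⊘ 1`, as a left ideal of `B`. -/
def kerIdeal : Ideal B where
  carrier := {x | iMap k B x = 0}
  add_mem' := by
    intro x y hx hy
    simp only [Set.mem_ofPred_eq] at hx hy ⊢
    rw [map_add, hx, hy, add_zero]
  zero_mem' := map_zero _
  smul_mem' := by
    intro a x hx
    have h := oslashMk_mul_eq_zero (k := k) (t := x ⊗ₜ[k] (1 : B)) hx (a ⊗ₜ[k] 1)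
    rwa [Algebra.TensorProduct.tmul_mul_tmul, mul_one] at h

variable {k B}

lemma mem_kerIdeal {x : B} : x ∈ kerIdeal k B ↔ iMap k B x = 0 := Iff.rfl

lemma iMap_apply (x : B) : iMap k B x = oslash k x (1 : B) := rfl

lemma oslash_eq_zero_of_mem {x : B} (hx : x ∈ kerIdeal k B) (c : B) : oslash k x c = 0 := by
  have h := oslashMk_mul_eq_zero (k := k) (t := x ⊗ₜ[k] (1 : B)) hx (1 ⊗ₜ[k] c)
  rwa [Algebra.TensorProduct.tmul_mul_tmul, mul_one, one_mul] at h

lemma oslash_induction {p : Oslash k B → Prop} (h0 : p 0) (hadd : ∀ a b, p a → p b → p (a + b))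
    (h : ∀ x y : B, p (oslash k x y)) (w : Oslash k B) : p w := by
  obtain ⟨t, rfl⟩ := Submodule.mkQ_surjective ((oslashIdeal k B).restrictScalars k) w
  change p (oslashMk k B t)
  induction t with
  | zero => rwa [map_zero]
  | add x y hx hy => rw [map_add]; exact hadd _ _ hx hy
  | tmul x y => exact h x y

variable {n : ℕ} {A : Matrix (Fin n) (Fin n) B}

/-- The defining relation of `B ⊘ B`, for the entries of a comatrix. -/
lemma IsComatrix.sum_oslash (hA : IsComatrix k A) (x y : B) (i j : Fin n) :
    ∑ l, oslash k (x * A i l) (y * A l j) = if i = j then oslash k x y else 0 := by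
  have h := oslashMk_mul_comul (k := k) (x ⊗ₜ[k] y) (A i j)
  rw [hA.comul_apply, hA.counit_apply, Finset.mul_sum, map_sum] at h
  simpa [Algebra.TensorProduct.tmul_mul_tmul, oslashMk_tmul, ite_smul] using h

/-- Right multiplication by a comatrix reflects membership of row vectors in `ker i_B`. -/
lemma IsComatrix.mem_kerIdeal_of_sum (hA : IsComatrix k A) {z : Fin n → B}
    (hz : ∀ j, ∑ i, z i * A i j ∈ kerIdeal k B) (j : Fin n) : z j ∈ kerIdeal k B := by
  rw [mem_kerIdeal, iMap_apply]
  calc oslash k (z j) (1 : B)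
      = ∑ i, ∑ l, oslash k (z i * A i l) (1 * A l j) := by
        simp_rw [hA.sum_oslash]
        simp
    _ = ∑ l, oslash k (∑ i, z i * A i l) (A l j) := by
        rw [Finset.sum_comm]
        simp [map_sum, LinearMap.sum_apply]
    _ = 0 := Finset.sum_eq_zero fun l _ => oslash_eq_zero_of_mem (hz l) _

/-- Over an Artinian bialgebra every comatrix has a left inverse modulo `ker i_B`: the powers of
the comatrix satisfy `Aᵐ = S Aᵐ⁺¹` for some `m`, and the factor `Aᵐ` can be cancelled modulo
`ker i_B`. -/
lemma IsComatrix.exists_left_inverse [IsArtinianRing B] (hA : IsComatrix k A) :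
    ∃ S : Matrix (Fin n) (Fin n) B, ∀ i j, (1 - S * A) i j ∈ kerIdeal k B := by
  let M := Matrix (Fin n) (Fin n) B
  let f : ℕ →o (Ideal M)ᵒᵈ :=
    ⟨fun m => OrderDual.toDual (Ideal.span {A ^ m}), monotone_nat_of_le_succ fun m => by
      change Ideal.span {A ^ (m + 1)} ≤ Ideal.span {A ^ m}
      rw [Ideal.span_singleton_le_iff_mem, Ideal.mem_span_singleton']
      exact ⟨A, (pow_succ' A m).symm⟩⟩
  obtain ⟨m, hm⟩ := IsArtinian.monotone_stabilizes f
  have h1 : Ideal.span {A ^ m} = Ideal.span {A ^ (m + 1)} := hm (m + 1) m.le_succ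
  have h2 : A ^ m ∈ Ideal.span {A ^ (m + 1)} := h1 ▸ Ideal.mem_span_singleton_self _
  obtain ⟨S, hS⟩ := Ideal.mem_span_singleton'.1 h2
  have hcancel : ∀ (p : ℕ) (Z : M), (∀ i j, (Z * A ^ p) i j ∈ kerIdeal k B) →
      ∀ i j, Z i j ∈ kerIdeal k B := by
    intro p
    induction p with
    | zero => intro Z hZ; simpa using hZ
    | succ p ih =>
      intro Z hZ
      refine ih Z fun i j => hA.mem_kerIdeal_of_sum (z := (Z * A ^ p) i) (fun j => ?_) j
      have := hZ i j
      rwa [pow_succ, ← mul_assoc, Matrix.mul_apply] at this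
  refine ⟨S, hcancel m _ fun i j => ?_⟩
  rw [sub_mul, one_mul, mul_assoc, ← pow_succ', hS, sub_self]
  exact (kerIdeal k B).zero_mem

/-- A left inverse modulo `ker i_B` of a comatrix moves its entries across `⊘`. -/
lemma IsComatrix.oslash_eq_of_left_inverse (hA : IsComatrix k A) {S : Matrix (Fin n) (Fin n) B}
    (hS : ∀ i j, (1 - S * A) i j ∈ kerIdeal k B) (x : B) (i j : Fin n) :
    oslash k x (A i j) = oslash k (x * S i j) 1 := by
  calc oslash k x (A i j)
      = ∑ l, oslash k (x * (1 : Matrix (Fin n) (Fin n) B) i l) (A l j) := by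
        rw [Finset.sum_eq_single i (fun l _ hl => by simp [Matrix.one_apply_ne' hl]) (by simp)]
        simp
    _ = ∑ l, oslash k (x * (S * A) i l) (A l j) := by
        refine Finset.sum_congr rfl fun l _ => ?_
        rw [← sub_eq_zero, ← LinearMap.sub_apply, ← map_sub, ← mul_sub, ← Matrix.sub_apply]
        exact oslash_eq_zero_of_mem ((kerIdeal k B).mul_mem_left x (hS i l)) _
    _ = ∑ p, ∑ l, oslash k (x * S i p * A p l) (1 * A l j) := by
        rw [Finset.sum_comm]
        simp [Matrix.mul_apply, Finset.mul_sum, mul_assoc, LinearMap.sum_apply]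
    _ = oslash k (x * S i j) 1 := by
        simp_rw [hA.sum_oslash]
        simp

/-- For an Artinian bialgebra, `i_B` is surjective. -/
theorem iMap_surjective [IsArtinianRing B] : Function.Surjective (iMap k B) := by
  intro w
  change w ∈ LinearMap.range (iMap k B)
  induction w using oslash_induction with
  | h0 => exact zero_mem _
  | hadd a b ha hb => exact add_mem ha hb
  | h x y =>
    obtain ⟨n, A, r, s, hA, rfl⟩ := exists_isComatrix (k := k) y
    obtain ⟨S, hS⟩ := hA.exists_left_inverse
    simp_rw [map_sum, map_smul]
    refine Submodule.sum_mem _ fun i _ => Submodule.sum_mem _ fun j _ =>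
      Submodule.smul_mem _ _ ⟨x * S i j, ?_⟩
    rw [hA.oslash_eq_of_left_inverse hS, iMap_apply]

/-- A left inverse of a comatrix modulo `ker i_B` is also a right inverse. -/
lemma IsComatrix.sum_mul_sub_mem (hA : IsComatrix k A) {S : Matrix (Fin n) (Fin n) B}
    (hS : ∀ i j, (1 - S * A) i j ∈ kerIdeal k B) (z : Fin n → B) (j : Fin n) :
    ∑ l, (∑ i, z i * A i l) * S l j - z j ∈ kerIdeal k B := by
  rw [mem_kerIdeal, map_sub, sub_eq_zero, iMap_apply, iMap_apply]
  calc oslash k (∑ l, (∑ i, z i * A i l) * S l j) (1 : B)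
      = ∑ l, oslash k (∑ i, z i * A i l) (A l j) := by
        simp_rw [hA.oslash_eq_of_left_inverse hS, map_sum, LinearMap.sum_apply]
    _ = ∑ i, ∑ l, oslash k (z i * A i l) (1 * A l j) := by
        rw [Finset.sum_comm]
        simp [map_sum, LinearMap.sum_apply]
    _ = oslash k (z j) 1 := by
        simp_rw [hA.sum_oslash]
        simp

/-- For an Artinian bialgebra, `ker i_B` is a two-sided ideal. Right multiplication by the inverse
`S` of a comatrix is a surjective endomorphism of the module `(B / ker i_B)ⁿ` of finite length, and
hence injective; so right multiplication by the comatrix preserves `(ker i_B)ⁿ`. -/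
theorem kerIdeal_isTwoSided [IsArtinianRing B] : (kerIdeal k B).IsTwoSided := by
  refine ⟨fun {a} b ha => ?_⟩
  obtain ⟨n, A, r, s, hA, rfl⟩ := exists_isComatrix (k := k) b
  simp_rw [Finset.mul_sum, mul_smul_comm]
  refine Submodule.sum_mem ((kerIdeal k B).restrictScalars k) fun i _ =>
    Submodule.sum_mem _ fun j _ => Submodule.smul_mem _ _ ?_
  obtain ⟨S, hS⟩ := hA.exists_left_inverse
  have hKS : ∀ l j, ∀ x ∈ kerIdeal k B, x * S l j ∈ kerIdeal k B := by
    intro l j x hx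
    rw [mem_kerIdeal, iMap_apply, ← hA.oslash_eq_of_left_inverse hS]
    exact oslash_eq_zero_of_mem hx _
  let R : Fin n → Fin n → (B ⧸ kerIdeal k B) →ₗ[B] (B ⧸ kerIdeal k B) := fun l j =>
    (kerIdeal k B).mapQ (kerIdeal k B) (LinearMap.toSpanSingleton B B (S l j)) (hKS l j)
  let Ψ : (Fin n → B ⧸ kerIdeal k B) →ₗ[B] (Fin n → B ⧸ kerIdeal k B) :=
    LinearMap.pi fun j => ∑ l, R l j ∘ₗ LinearMap.proj l
  have hΨ : ∀ (y : Fin n → B) (j : Fin n), Ψ (fun l => (kerIdeal k B).mkQ (y l)) j =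
      (kerIdeal k B).mkQ (∑ l, y l * S l j) := by
    intro y j
    simp [Ψ, R, map_sum]
    rfl
  have hΨA : ∀ z : Fin n → B, Ψ (fun l => (kerIdeal k B).mkQ (∑ i, z i * A i l)) =
      fun j => (kerIdeal k B).mkQ (z j) := by
    intro z
    ext j
    rw [hΨ, ← sub_eq_zero, ← map_sub]
    exact (Submodule.Quotient.mk_eq_zero _).2 (hA.sum_mul_sub_mem hS z j)
  have hsurj : Function.Surjective Ψ := by
    intro w
    choose z hz using fun j => (kerIdeal k B).mkQ_surjective (w j)
    exact ⟨_, (hΨA z).trans (funext hz)⟩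
  have hinj := IsNoetherian.injective_of_surjective_endomorphism Ψ hsurj
  have h0 := hΨA (Pi.single i a)
  have h1 : (fun j => (kerIdeal k B).mkQ ((Pi.single i a : Fin n → B) j)) = 0 := by
    ext j
    refine (Submodule.Quotient.mk_eq_zero _).2 ?_
    by_cases hij : j = i
    · subst hij; simpa using ha
    · simp [Pi.single_eq_of_ne hij]
  rw [h1] at h0
  have h2 := congrFun (hinj (h0.trans (map_zero Ψ).symm)) j
  have h3 := (Submodule.Quotient.mk_eq_zero _).1 h2
  simpa [Pi.single_apply, ite_mul] using h3

lemma comul_iMap (x : B) : Coalgebra.comul (R := k) (iMap k B x) =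
    TensorProduct.map (iMap k B) (iMap k B) (Coalgebra.comul (R := k) x) := by
  rw [iMap_apply, comul_oslash]
  have h : copComul k B (x ⊗ₜ[k] (1 : B)) = TensorProduct.map
      ((TensorProduct.mk k B B).flip 1) ((TensorProduct.mk k B B).flip 1)
      (Coalgebra.comul (R := k) x) := by
    simp only [copComul, AlgHom.comp_apply, Algebra.TensorProduct.map_tmul, map_one,
      Bialgebra.comulAlgHom_apply]
    generalize Coalgebra.comul (R := k) x = z
    induction z with
    | zero => simp
    | add x y hx hy => simp only [map_add, TensorProduct.add_tmul, hx, hy]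
    | tmul x y => rfl
  rw [h, ← LinearMap.comp_apply, ← TensorProduct.map_comp]
  rfl

lemma counit_iMap (x : B) : Coalgebra.counit (R := k) (iMap k B x) =
    Coalgebra.counit (R := k) x := by
  rw [iMap_apply, counit_oslash]
  simp

variable (k B) in
/-- The injection `B / ker i_B → B ⊘ B` induced by `i_B`. -/
def iBar : (B ⧸ kerIdeal k B) →ₗ[k] Oslash k B :=
  ((kerIdeal k B).restrictScalars k).liftQ (iMap k B) (fun _ hx => hx)

lemma iBar_mk (x : B) : iBar k B ((kerIdeal k B).mkQ x) = iMap k B x := rfl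

lemma iBar_injective : Function.Injective (iBar k B) := by
  refine (injective_iff_map_eq_zero _).2 fun w hw => ?_
  obtain ⟨x, rfl⟩ := (kerIdeal k B).mkQ_surjective w
  exact (Submodule.Quotient.mk_eq_zero _).2 hw

/-- `ker i_B` is a coideal, since `i_B` is a coalgebra map. -/
instance kerIdeal_isCoideal : ((kerIdeal k B).restrictScalars k).IsCoideal where
  counit_eq_zero x hx := by
    have hx' : iMap k B x = 0 := hx
    rw [← counit_iMap, hx', map_zero]
  map_mkQ_comul_eq_zero x hx := by
    have hx' : iMap k B x = 0 := hx
    let j := ((kerIdeal k B).restrictScalars k).liftQ (iMap k B) (fun _ hx => hx)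
    have hj : Function.Injective j := iBar_injective
    apply TensorProduct.map_injective_of_flat_flat j j hj hj
    rw [← LinearMap.comp_apply, ← TensorProduct.map_comp, map_zero]
    have h := comul_iMap (k := k) x
    rw [hx', map_zero] at h
    exact h.symm

lemma hat_iMap {L : Type u} [Ring L] [HopfAlgebra k L] (g : B →ₐc[k] L) (x : B) :
    hat g (iMap k B x) = g x := by
  rw [iMap_apply, hat_oslash, map_one, HopfAlgebra.antipode_one, mul_one]

end Kernel

/-! ### The Hopf envelope `B / ker i_B` -/

section QuotientHopf

variable {k : Type v} {B : Type u} [Field k] [Ring B] [Bialgebra k B] [IsArtinianRing B]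

instance : (kerIdeal k B).IsTwoSided := kerIdeal_isTwoSided

variable (k B) in
/-- For an Artinian bialgebra, `i_B` induces a linear isomorphism `B / ker i_B ≃ B ⊘ B`. -/
def iBarEquiv : (B ⧸ kerIdeal k B) ≃ₗ[k] Oslash k B :=
  LinearEquiv.ofBijective (iBar k B) ⟨iBar_injective, fun w => by
    obtain ⟨x, rfl⟩ := iMap_surjective w
    exact ⟨_, iBar_mk x⟩⟩

lemma iBarEquiv_mk (x : B) : iBarEquiv k B (Ideal.Quotient.mk _ x) = iMap k B x := rfl

variable (k B) in
/-- The map `B → B / ker i_B` that sends `y` to the class corresponding to `1 ⊘ y`: the composite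
of the quotient map with the antipode of `B / ker i_B`. -/
def preAntipode : B →ₗ[k] B ⧸ kerIdeal k B :=
  (iBarEquiv k B).symm.toLinearMap ∘ₗ oslash k (1 : B)

variable (k) in
/-- The image in `B / ker i_B` of a matrix over `B`. -/
abbrev quotMatrix {n : ℕ} (A : Matrix (Fin n) (Fin n) B) :
    Matrix (Fin n) (Fin n) (B ⧸ kerIdeal k B) :=
  A.map (Ideal.Quotient.mk (kerIdeal k B))

variable {n : ℕ} {A : Matrix (Fin n) (Fin n) B}

/-- Modulo `ker i_B`, a comatrix is invertible with inverse given by `preAntipode`. -/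
lemma IsComatrix.preAntipode_inverse (hA : IsComatrix k A) :
    A.map (preAntipode k B) * quotMatrix k A = 1 ∧
      quotMatrix k A * A.map (preAntipode k B) = 1 := by
  obtain ⟨S, hS⟩ := hA.exists_left_inverse
  have h1 : A.map (preAntipode k B) = quotMatrix k S := by
    ext i j
    simp only [Matrix.map_apply, preAntipode, LinearMap.comp_apply, LinearEquiv.coe_coe]
    rw [LinearEquiv.symm_apply_eq, iBarEquiv_mk, hA.oslash_eq_of_left_inverse hS, one_mul,
      iMap_apply]
  rw [h1]
  constructor
  · rw [quotMatrix, quotMatrix, ← Matrix.map_mul]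
    refine Eq.trans ?_ (Matrix.map_one _ (map_zero (Ideal.Quotient.mk (kerIdeal k B))) (map_one _))
    ext i j
    have := Ideal.Quotient.eq_zero_iff_mem.2 (hS i j)
    rw [Matrix.sub_apply, map_sub, sub_eq_zero] at this
    exact this.symm
  · rw [quotMatrix, quotMatrix, ← Matrix.map_mul]
    refine Eq.trans ?_ (Matrix.map_one _ (map_zero (Ideal.Quotient.mk (kerIdeal k B))) (map_one _))
    ext i j
    have := Ideal.Quotient.eq_zero_iff_mem.2 (hA.sum_mul_sub_mem hS (Pi.single i 1) j)
    simp only [Pi.single_apply, ite_mul, one_mul, zero_mul, Finset.sum_ite_eq', Finset.mem_univ,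
      if_true, map_sub, sub_eq_zero] at this
    rw [Matrix.map_apply, Matrix.mul_apply, this, Matrix.map_apply, Matrix.one_apply]
    simp_rw [eq_comm]

/-- `preAntipode` vanishes on `ker i_B`. For `x = ∑ᵢ rᵢ vᵢ` with `vᵢ = ∑ⱼ sⱼ aᵢⱼ`, right
multiplication by the comatrix `(aᵢⱼ)` is an injective endomorphism of the module of finite length
`N = {z | ∑ᵢ zᵢ ⊗ vᵢ = 0}` over `H = B / ker i_B`, hence bijective on it; so the row
`r (aᵢⱼ)⁻¹` lies in `N` whenever `r` does. -/
lemma preAntipode_eq_zero {x : B} (hx : x ∈ kerIdeal k B) : preAntipode k B x = 0 := by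
  let H := B ⧸ kerIdeal k B
  obtain ⟨n, A, r, s, hA, hxA⟩ := exists_isComatrix (k := k) x
  obtain ⟨h1, h2⟩ := hA.preAntipode_inverse
  let q : B →ₐ[k] H := Ideal.Quotient.mkₐ k (kerIdeal k B)
  let v : Fin n → B := fun i => ∑ j, s j • A i j
  have hv : ∀ i, Coalgebra.comul (R := k) (v i) = ∑ l, A i l ⊗ₜ[k] v l := by
    intro i
    simp_rw [v, map_sum, map_smul, hA.comul_apply, TensorProduct.tmul_sum, Finset.smul_sum,
      TensorProduct.tmul_smul]
    rw [Finset.sum_comm]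
  have hqv : ∀ i, Coalgebra.comul (R := k) (q (v i)) = ∑ l, q (A i l) ⊗ₜ[k] q (v l) := by
    intro i
    have : Coalgebra.comul (R := k) (q (v i)) = TensorProduct.map q.toLinearMap q.toLinearMap
      (Coalgebra.comul (R := k) (v i)) := rfl
    rw [this, hv, map_sum]
    rfl
  have hεv : ∀ i, Coalgebra.counit (R := k) (q (v i)) = s i := by
    intro i
    have : Coalgebra.counit (R := k) (q (v i)) = Coalgebra.counit (R := k) (v i) := rfl
    rw [this]
    simp [v, hA.counit_apply]
  -- the linear map `a ⊗ b ↦ (a ⊗ 1) Δ(b)`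
  let F : H ⊗[k] H →ₗ[k] H ⊗[k] H := LinearMap.mul' k (H ⊗[k] H) ∘ₗ
    TensorProduct.map (Algebra.TensorProduct.includeLeft (R := k) (S := k) (A := H) (B := H)
      |>.toLinearMap) Coalgebra.comul
  let N : Submodule H (Fin n → H) :=
    { carrier := {z | ∑ i, z i ⊗ₜ[k] q (v i) = 0}
      add_mem' := by
        intro a b ha hb
        simp only [Set.mem_ofPred_eq] at ha hb ⊢
        simp only [Pi.add_apply, TensorProduct.add_tmul, Finset.sum_add_distrib, ha, hb, add_zero]
      zero_mem' := by simp
      smul_mem' := by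
        intro c a ha
        simp only [Set.mem_ofPred_eq] at ha ⊢
        simp only [Pi.smul_apply, ← TensorProduct.smul_tmul', ← Finset.smul_sum, ha, smul_zero] }
  have hN : ∀ z ∈ N, (quotMatrix k A).vecMulLinear z ∈ N := by
    intro z hz
    have hz' : ∑ i, z i ⊗ₜ[k] q (v i) = 0 := hz
    change ∑ l, (∑ i, z i * q (A i l)) ⊗ₜ[k] q (v l) = 0
    have h3 := congrArg F hz'
    rw [map_zero, map_sum] at h3
    rw [← h3]
    simp_rw [TensorProduct.sum_tmul]
    rw [Finset.sum_comm]
    refine Finset.sum_congr rfl fun i _ => ?_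
    simp only [F, LinearMap.comp_apply, TensorProduct.map_tmul, hqv, LinearMap.mul'_apply,
      AlgHom.toLinearMap_apply, Algebra.TensorProduct.includeLeft_apply, Finset.mul_sum,
      Algebra.TensorProduct.tmul_mul_tmul, one_mul]
  let f : N →ₗ[H] N := (quotMatrix k A).vecMulLinear.restrict hN
  have hcancel : ∀ z : Fin n → H, Matrix.vecMul (Matrix.vecMul z (quotMatrix k A))
      (A.map (preAntipode k B)) = z := by
    intro z
    rw [Matrix.vecMul_vecMul, h2, Matrix.vecMul_one]
  have hf : Function.Injective f := by
    intro z w hzw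
    ext1
    rw [← hcancel z, ← hcancel w]
    exact congrArg (fun y => Matrix.vecMul y (A.map (preAntipode k B))) (congrArg Subtype.val hzw)
  have hrN : (fun i => algebraMap k H (r i)) ∈ N := by
    change ∑ i, algebraMap k H (r i) ⊗ₜ[k] q (v i) = 0
    have h3 : ∑ i, r i • q (v i) = 0 := by
      have h4 : q x = 0 := Ideal.Quotient.eq_zero_iff_mem.2 hx
      rw [hxA] at h4
      simpa [v, Finset.smul_sum, mul_smul, map_sum] using h4
    simp_rw [Algebra.algebraMap_eq_smul_one, TensorProduct.smul_tmul]
    rw [← TensorProduct.tmul_sum, h3, TensorProduct.tmul_zero]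
  obtain ⟨⟨y, hy⟩, hfy⟩ := IsArtinian.surjective_of_injective_endomorphism f hf ⟨_, hrN⟩
  have hfy' : Matrix.vecMul y (quotMatrix k A) = fun i => algebraMap k H (r i) :=
    congrArg Subtype.val hfy
  have hy' := hcancel y
  rw [hfy'] at hy'
  have hyN : ∑ i, y i ⊗ₜ[k] q (v i) = 0 := hy
  have h5 := congrArg (sliceRight (Coalgebra.counit (R := k) (A := H))) hyN
  simp only [map_sum, sliceRight_tmul, hεv, map_zero] at h5
  rw [← h5, hxA, ← hy']
  simp only [map_sum, map_smul, Matrix.vecMul, dotProduct, Matrix.map_apply, Finset.smul_sum]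
  rw [Finset.sum_comm]
  refine Finset.sum_congr rfl fun j _ => Finset.sum_congr rfl fun i _ => ?_
  rw [← Algebra.smul_def, smul_smul, mul_comm]

variable (k B) in
/-- The antipode of `B / ker i_B`. -/
def quotAntipode : (B ⧸ kerIdeal k B) →ₗ[k] (B ⧸ kerIdeal k B) :=
  ((kerIdeal k B).restrictScalars k).liftQ (preAntipode k B) (fun _ hx => preAntipode_eq_zero hx)

lemma linearMap_quotient_ext {M : Type*} [AddCommGroup M] [Module k M]
    {f g : (B ⧸ kerIdeal k B) →ₗ[k] M}
    (h : ∀ (n : ℕ) (A : Matrix (Fin n) (Fin n) B), IsComatrix k A →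
      ∀ i j, f (Ideal.Quotient.mk _ (A i j)) = g (Ideal.Quotient.mk _ (A i j))) : f = g := by
  have h1 : f ∘ₗ (Ideal.Quotient.mkₐ k (kerIdeal k B)).toLinearMap =
      g ∘ₗ (Ideal.Quotient.mkₐ k (kerIdeal k B)).toLinearMap := linearMap_ext_of_isComatrix h
  refine LinearMap.ext fun x => ?_
  obtain ⟨b, rfl⟩ := Ideal.Quotient.mk_surjective x
  exact DFunLike.congr_fun h1 b

/-- For an Artinian bialgebra `B`, the quotient `B / ker i_B` is a Hopf algebra. -/
instance quotHopfAlgebra : HopfAlgebra k (B ⧸ kerIdeal k B) where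
  antipode := quotAntipode k B
  mul_antipode_rTensor_comul := linearMap_quotient_ext fun n A hA i j => by
    have h := congrFun (congrFun hA.preAntipode_inverse.1 i) j
    simp only [LinearMap.comp_apply, Bialgebra.Quotient.comul_mk, hA.comul_apply, map_sum,
      Bialgebra.Quotient.counit_mk, hA.counit_apply, TensorProduct.map_tmul,
      LinearMap.rTensor_tmul, LinearMap.mul'_apply]
    rw [Matrix.mul_apply] at h
    refine Eq.trans h ?_
    rw [Matrix.one_apply]
    split_ifs <;> simp
  mul_antipode_lTensor_comul := linearMap_quotient_ext fun n A hA i j => by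
    have h := congrFun (congrFun hA.preAntipode_inverse.2 i) j
    simp only [LinearMap.comp_apply, Bialgebra.Quotient.comul_mk, hA.comul_apply, map_sum,
      Bialgebra.Quotient.counit_mk, hA.counit_apply, TensorProduct.map_tmul,
      LinearMap.lTensor_tmul, LinearMap.mul'_apply]
    rw [Matrix.mul_apply] at h
    refine Eq.trans h ?_
    rw [Matrix.one_apply]
    split_ifs <;> simp

variable (k B) in
/-- The quotient map `B → B / ker i_B`. -/
abbrev quotMap : B →ₐc[k] B ⧸ kerIdeal k B := Bialgebra.Quotient.mkBialgHom (kerIdeal k B)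

lemma quotMap_surjective : Function.Surjective (quotMap k B) := Ideal.Quotient.mk_surjective

lemma quotMap_eq_zero {x : B} : quotMap k B x = 0 ↔ iMap k B x = 0 :=
  Ideal.Quotient.eq_zero_iff_mem

/-- For an Artinian bialgebra `B`, the quotient `B / ker i_B` is the Hopf envelope of `B`: a
bialgebra map `g` to a Hopf algebra satisfies `ĝ ∘ i_B = g`, so it kills `ker i_B`. -/
theorem isHopfEnvelope_quotMap : IsHopfEnvelope (quotMap k B) := by
  intro L _ _ g
  have hg : ∀ x ∈ kerIdeal k B, (g : B →ₐ[k] L) x = 0 := by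
    intro x hx
    change g x = 0
    rw [← hat_iMap, mem_kerIdeal.1 hx, map_zero]
  let h₀ : (B ⧸ kerIdeal k B) →ₐ[k] L := Ideal.Quotient.liftₐ (kerIdeal k B) (g : B →ₐ[k] L) hg
  have h₀_mk : ∀ x, h₀ (Ideal.Quotient.mk _ x) = g x := fun x => rfl
  let h : (B ⧸ kerIdeal k B) →ₐc[k] L := BialgHom.ofAlgHom h₀
    (Ideal.Quotient.algHom_ext k <| AlgHom.ext fun x => CoalgHomClass.counit_comp_apply g x)
    (Ideal.Quotient.algHom_ext k <| AlgHom.ext fun x => by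
      refine Eq.trans ?_ (CoalgHomClass.map_comp_comul_apply g x)
      change Algebra.TensorProduct.map h₀ h₀ (TensorProduct.map
        (Ideal.Quotient.mkₐ k (kerIdeal k B)).toLinearMap
        (Ideal.Quotient.mkₐ k (kerIdeal k B)).toLinearMap (Coalgebra.comul (R := k) x)) = _
      generalize Coalgebra.comul (R := k) x = z
      induction z with
      | zero => simp
      | add x y hx hy => simp only [map_add, hx, hy]
      | tmul x y => rfl)
  refine ⟨h, ?_, ?_⟩
  · ext x
    rfl
  · intro h' hh'
    ext x
    obtain ⟨b, rfl⟩ := Ideal.Quotient.mk_surjective x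
    exact DFunLike.congr_fun hh' b

/-- Every Hopf envelope `q` of an Artinian bialgebra is surjective with kernel `ker i_B`. -/
theorem IsHopfEnvelope.surjective_and_ker {H : Type u} [Ring H] [HopfAlgebra k H] {q : B →ₐc[k] H}
    (hq : IsHopfEnvelope q) :
    Function.Surjective q ∧ ∀ x, q x = 0 ↔ iMap k B x = 0 := by
  obtain ⟨a, ha, -⟩ := hq _ (quotMap k B)
  obtain ⟨b, hb, -⟩ := isHopfEnvelope_quotMap (k := k) H q
  obtain ⟨c, -, hc⟩ := hq H q
  have hab : b.comp a = BialgHom.id k H := by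
    refine (hc (b.comp a) ?_).trans (hc _ ?_).symm
    · change (b.comp a).comp q = q
      rw [BialgHom.comp_assoc, ha, hb]
    · exact BialgHom.id_comp _
  have hbq : ∀ x, b (quotMap k B x) = q x := fun x => DFunLike.congr_fun hb x
  have haq : ∀ x, a (q x) = quotMap k B x := fun x => DFunLike.congr_fun ha x
  refine ⟨fun y => ?_, fun x => ?_⟩
  · obtain ⟨x, hx⟩ := quotMap_surjective (a y)
    refine ⟨x, ?_⟩
    rw [← hbq, hx]
    exact DFunLike.congr_fun hab y
  · rw [← quotMap_eq_zero, ← haq]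
    refine ⟨fun h => by rw [h, map_zero], fun h => ?_⟩
    have := DFunLike.congr_fun hab (q x)
    change b (a (q x)) = q x at this
    rw [← this, h, map_zero]

end QuotientHopf

/-! ### Left integrals in the dual of a coalgebra -/

section LeftIntegrals

variable {k : Type v} {C : Type u} [Field k] [AddCommGroup C] [Module k C]

lemma mul'_map_eq_apply_sliceRight (μ f : Module.Dual k C) (z : C ⊗[k] C) :
    LinearMap.mul' k k (TensorProduct.map μ f z) = μ (sliceRight f z) := by
  induction z with
  | zero => simp
  | add x y hx hy => simp [hx, hy]
  | tmul x y => simp [mul_comm]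

/-- A functional `f` is a left integral if and only if `x₁ f(x₂) = f(x) e` for all `x`. -/
lemma mem_leftIntegrals_iff [CoalgebraStruct k C] {e : C} {f : Module.Dual k C} :
    f ∈ leftIntegrals k C e ↔
      ∀ x, sliceRight f (Coalgebra.comul (R := k) x) = f x • e := by
  have key : ∀ (μ : Module.Dual k C) (x : C),
      (WithConv.toConv μ * WithConv.toConv f : WithConv (C →ₗ[k] k)).ofConv x =
        μ (sliceRight f (Coalgebra.comul (R := k) x)) :=
    fun μ x => mul'_map_eq_apply_sliceRight μ f _
  constructor
  · intro hf x
    rw [← sub_eq_zero, ← Module.forall_dual_apply_eq_zero_iff k]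
    intro μ
    have h1 := hf μ
    have h2 := congrArg (fun g : WithConv (C →ₗ[k] k) => g.ofConv x) h1
    simp only [key] at h2
    rw [map_sub, h2, map_smul, sub_eq_zero]
    change μ e * f x = f x * μ e
    exact mul_comm _ _
  · intro hf μ
    apply WithConv.ofConv_injective
    refine LinearMap.ext fun x => ?_
    rw [key, hf, map_smul]
    change f x * μ e = μ e * f x
    exact mul_comm _ _

end LeftIntegrals

/-! ### The antipode and the comultiplication -/

section AntipodeComul

variable {k : Type v} {H : Type u} [Field k] [Ring H] [HopfAlgebra k H]
  {n : ℕ} {A : Matrix (Fin n) (Fin n) H}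

/-- The antipode reverses the comultiplication: both sides are the inverse of the matrix
`(Δ(aᵢⱼ))`. -/
lemma IsComatrix.comul_antipode (hA : IsComatrix k A) (i j : Fin n) :
    Coalgebra.comul (R := k) (HopfAlgebra.antipode k (A i j)) =
      ∑ l, HopfAlgebra.antipode k (A l j) ⊗ₜ[k] HopfAlgebra.antipode k (A i l) := by
  let M₁ : Matrix (Fin n) (Fin n) (H ⊗[k] H) :=
    fun i j => Coalgebra.comul (R := k) (HopfAlgebra.antipode k (A i j))
  let M : Matrix (Fin n) (Fin n) (H ⊗[k] H) := fun i j => Coalgebra.comul (R := k) (A i j)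
  let M₂ : Matrix (Fin n) (Fin n) (H ⊗[k] H) :=
    fun i j => ∑ l, HopfAlgebra.antipode k (A l j) ⊗ₜ[k] HopfAlgebra.antipode k (A i l)
  have h1 : M₁ * M = 1 := by
    ext i j
    rw [Matrix.mul_apply]
    simp only [M₁, M, ← Bialgebra.comul_mul]
    rw [← map_sum, hA.antipode_mul, Matrix.one_apply]
    split_ifs <;> simp
  have h2 : M * M₂ = 1 := by
    ext i j
    rw [Matrix.mul_apply]
    calc ∑ m, M i m * M₂ m j
        = ∑ p, ∑ l, (A i l * HopfAlgebra.antipode k (A p j)) ⊗ₜ[k]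
            (∑ m, A l m * HopfAlgebra.antipode k (A m p)) := by
          simp only [M, M₂, hA.comul_apply, Finset.sum_mul, Finset.mul_sum,
            Algebra.TensorProduct.tmul_mul_tmul, TensorProduct.tmul_sum]
          rw [Finset.sum_comm]
          refine Finset.sum_congr rfl fun l _ => ?_
          rw [Finset.sum_comm]
      _ = (∑ l, A i l * HopfAlgebra.antipode k (A l j)) ⊗ₜ[k] 1 := by
          rw [TensorProduct.sum_tmul]
          simp_rw [hA.mul_antipode, TensorProduct.tmul_ite]
          simp
      _ = (1 : Matrix (Fin n) (Fin n) (H ⊗[k] H)) i j := by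
          rw [hA.mul_antipode, Matrix.one_apply]
          split_ifs <;> simp [Algebra.TensorProduct.one_def]
  have h3 : M₁ = M₂ := left_inv_eq_right_inv h1 h2
  exact congrFun (congrFun h3 i) j

lemma IsComatrix.antipode_transpose (hA : IsComatrix k A) :
    IsComatrix k (fun i j => HopfAlgebra.antipode k (A j i)) where
  comul_apply i j := hA.comul_antipode j i
  counit_apply i j := by
    rw [HopfAlgebra.counit_antipode, hA.counit_apply]
    simp_rw [eq_comm]

/-- The identity `Δ(S(h₁)) (h₂ ⊗ 1) = 1 ⊗ S(h)` for the entries of a comatrix. -/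
lemma IsComatrix.sum_comul_antipode_mul (hA : IsComatrix k A) (i j : Fin n) :
    ∑ l, Coalgebra.comul (R := k) (HopfAlgebra.antipode k (A i l)) * (A l j ⊗ₜ[k] 1) =
      1 ⊗ₜ[k] HopfAlgebra.antipode k (A i j) := by
  simp_rw [hA.comul_antipode, Finset.sum_mul, Algebra.TensorProduct.tmul_mul_tmul, mul_one]
  rw [Finset.sum_comm]
  simp_rw [← TensorProduct.sum_tmul, hA.antipode_mul, TensorProduct.ite_tmul]
  simp

end AntipodeComul

/-! ### The Hopf module `H*` and its integrals -/

section DualHopfModule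

variable {k : Type v} {H : Type u} [Field k] [Ring H] [HopfAlgebra k H]

/-- The functional `μ ⊗ f` on `H ⊗ H`. -/
abbrev dualTmul (μ f : Module.Dual k H) : Module.Dual k (H ⊗[k] H) :=
  TensorProduct.dualDistrib k H H (μ ⊗ₜ[k] f)

variable (k H) in
/-- The convolution product `(μ * f)(x) = μ(x₁) f(x₂)` on `H*`, as a bilinear map. -/
def convDual : Module.Dual k H →ₗ[k] Module.Dual k H →ₗ[k] Module.Dual k H :=
  (TensorProduct.mk k (Module.Dual k H) (Module.Dual k H)).compr₂
    ((Coalgebra.comul (R := k) (A := H)).dualMap ∘ₗ TensorProduct.dualDistrib k H H)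

lemma convDual_apply (μ f : Module.Dual k H) (x : H) :
    convDual k H μ f x = dualTmul μ f (Coalgebra.comul (R := k) x) := rfl

lemma IsComatrix.convDual_apply {n : ℕ} {A : Matrix (Fin n) (Fin n) H} (hA : IsComatrix k A)
    (μ f : Module.Dual k H) (i j : Fin n) :
    convDual k H μ f (A i j) = ∑ l, μ (A i l) * f (A l j) := by
  rw [BialgIntegral.convDual_apply, hA.comul_apply, map_sum]
  simp

lemma convDual_assoc (μ ν f : Module.Dual k H) :
    convDual k H (convDual k H μ ν) f = convDual k H μ (convDual k H ν f) :=
  linearMap_ext_of_isComatrix fun n A hA i j => by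
    simp_rw [hA.convDual_apply, Finset.sum_mul, Finset.mul_sum, mul_assoc]
    exact Finset.sum_comm

lemma counit_convDual (f : Module.Dual k H) :
    convDual k H (Coalgebra.counit (R := k) (A := H)) f = f :=
  linearMap_ext_of_isComatrix fun n A hA i j => by
    simp [hA.convDual_apply, hA.counit_apply]

lemma dualTmul_eq (μ f : Module.Dual k H) (z : H ⊗[k] H) :
    dualTmul μ f z = μ (sliceRight f z) := by
  induction z with
  | zero => simp
  | add x y hx hy => rw [map_add, map_add, map_add, hx, hy]
  | tmul x y => simp [mul_comm]

/-- The compatibility of the dual bases of `H*` and `H` with convolution and comultiplication: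
`∑ₘ eᵐ ⊗ Δ(eₘ) = ∑ᵢⱼ (eⁱ * eʲ) ⊗ (eᵢ ⊗ eⱼ)`. -/
lemma sum_coord_comul {ι M : Type*} [Fintype ι] (b : Module.Basis ι k H) [AddCommGroup M]
    [Module k M] (G : Module.Dual k H →ₗ[k] (H ⊗[k] H) →ₗ[k] M) :
    ∑ m, G (b.coord m) (Coalgebra.comul (R := k) (b m)) =
      ∑ i, ∑ j, G (convDual k H (b.coord i) (b.coord j)) (b i ⊗ₜ[k] b j) := by
  classical
  have h1 : ∀ m, Coalgebra.comul (R := k) (b m) =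
      ∑ i, ∑ j, convDual k H (b.coord i) (b.coord j) (b m) • (b i ⊗ₜ[k] b j) := by
    intro m
    have key : ∀ z : H ⊗[k] H, z =
        ∑ i, ∑ j, dualTmul (b.coord i) (b.coord j) z • (b i ⊗ₜ[k] b j) := by
      intro z
      induction z with
      | zero => simp
      | add x y hx hy =>
        conv_lhs => rw [hx, hy]
        simp only [map_add, add_smul, Finset.sum_add_distrib]
      | tmul x y =>
        conv_lhs => rw [← b.sum_repr x, ← b.sum_repr y]
        simp_rw [TensorProduct.sum_tmul, TensorProduct.tmul_sum, TensorProduct.smul_tmul_smul]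
        simp
    exact key _
  have h2 : ∀ f : Module.Dual k H, f = ∑ m, f (b m) • b.coord m := by
    intro f
    refine b.ext fun i => ?_
    simp
  calc ∑ m, G (b.coord m) (Coalgebra.comul (R := k) (b m))
      = ∑ m, ∑ i, ∑ j, convDual k H (b.coord i) (b.coord j) (b m) •
          G (b.coord m) (b i ⊗ₜ[k] b j) := by
        refine Finset.sum_congr rfl fun m _ => ?_
        conv_lhs => rw [h1 m]
        simp only [map_sum, map_smul]
    _ = ∑ i, ∑ j, ∑ m, convDual k H (b.coord i) (b.coord j) (b m) •
          G (b.coord m) (b i ⊗ₜ[k] b j) := by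
        rw [Finset.sum_comm]
        exact Finset.sum_congr rfl fun i _ => Finset.sum_comm
    _ = _ := by
        refine Finset.sum_congr rfl fun i _ => Finset.sum_congr rfl fun j _ => ?_
        conv_rhs => rw [h2 (convDual k H (b.coord i) (b.coord j))]
        simp only [map_sum, map_smul, LinearMap.sum_apply, LinearMap.smul_apply]

/-- The identity `∑ᵢ μ(y₁ S(eᵢ)) (eⁱ * g)(y₂) = μ(1) g(y)` for dual bases: summing over `i` turns
the left side into `μ(y₁ S(y₂)) g(y₃)`. -/
lemma sum_dualTmul_convDual {ι : Type*} [Fintype ι] (b : Module.Basis ι k H)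
    (μ g : Module.Dual k H) (y : H) :
    ∑ i, dualTmul μ (convDual k H (b.coord i) g) (Coalgebra.comul (R := k) y *
      (HopfAlgebra.antipode k (b i) ⊗ₜ[k] 1)) = μ 1 * g y := by
  obtain ⟨n, A, r, s, hA, rfl⟩ := exists_isComatrix (k := k) y
  have key : ∀ p q, ∑ i, dualTmul μ (convDual k H (b.coord i) g)
      (Coalgebra.comul (R := k) (A p q) * (HopfAlgebra.antipode k (b i) ⊗ₜ[k] 1)) =
        μ 1 * g (A p q) := by
    intro p q
    calc ∑ i, dualTmul μ (convDual k H (b.coord i) g)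
          (Coalgebra.comul (R := k) (A p q) * (HopfAlgebra.antipode k (b i) ⊗ₜ[k] 1))
        = ∑ i, ∑ l, ∑ m, μ (A p l * HopfAlgebra.antipode k (b i)) *
            (b.coord i (A l m) * g (A m q)) := by
          simp [hA.comul_apply, Finset.sum_mul, hA.convDual_apply, Finset.mul_sum]
      _ = ∑ m, ∑ l, μ (A p l * HopfAlgebra.antipode k (∑ i, b.coord i (A l m) • b i)) *
            g (A m q) := by
          simp only [map_sum, map_smul, Finset.mul_sum, mul_smul_comm, Finset.sum_mul,
            smul_eq_mul]
          refine (Finset.sum_congr rfl fun i _ => Finset.sum_comm).trans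
            (Finset.sum_comm.trans (Finset.sum_congr rfl fun m _ => Finset.sum_comm.trans ?_))
          exact Finset.sum_congr rfl fun l _ => Finset.sum_congr rfl fun i _ => by ring
      _ = ∑ m, μ (∑ l, A p l * HopfAlgebra.antipode k (A l m)) * g (A m q) := by
          simp_rw [Module.Basis.coord_apply, b.sum_repr, map_sum, Finset.sum_mul]
      _ = μ 1 * g (A p q) := by
          simp_rw [hA.mul_antipode]
          simp [apply_ite μ]
  simp only [map_sum, map_smul, Finset.sum_mul, smul_mul_assoc]
  rw [Finset.sum_comm]
  simp_rw [Finset.mul_sum]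
  refine Finset.sum_congr rfl fun p _ => ?_
  rw [Finset.sum_comm]
  refine Finset.sum_congr rfl fun q _ => ?_
  rw [← Finset.smul_sum, key, smul_eq_mul, smul_eq_mul]
  ring

/-- The action `h ↦ τ(– S(h))` of `H` on a functional `τ`. -/
def antipodeAct (τ : Module.Dual k H) : H →ₗ[k] Module.Dual k H :=
  LinearMap.llcomp k H H k τ ∘ₗ (LinearMap.mul k H).flip ∘ₗ HopfAlgebra.antipode k

lemma antipodeAct_apply (τ : Module.Dual k H) (h x : H) :
    antipodeAct τ h x = τ (x * HopfAlgebra.antipode k h) := rfl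

/-- For a left integral `τ`, `τ(x S(h₁)) h₂ = x₁ τ(x₂ S(h))`. -/
lemma antipodeAct_sliceRight {τ : Module.Dual k H} (hτ : τ ∈ hopfLeftIntegrals k H)
    (φ : Module.Dual k H) (h x : H) :
    antipodeAct τ (sliceRight φ (Coalgebra.comul (R := k) h)) x =
      dualTmul φ (antipodeAct τ h) (Coalgebra.comul (R := k) x) := by
  rw [mem_leftIntegrals_iff] at hτ
  obtain ⟨n, A, r, s, hA, rfl⟩ := exists_isComatrix (k := k) h
  have key : ∀ i j, antipodeAct τ (sliceRight φ (Coalgebra.comul (R := k) (A i j))) x =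
      dualTmul φ (antipodeAct τ (A i j)) (Coalgebra.comul (R := k) x) := by
    intro i j
    have h1 : antipodeAct τ (A i j) = τ ∘ₗ LinearMap.mulRight k (HopfAlgebra.antipode k (A i j)) :=
      rfl
    rw [h1, dualTmul_eq, ← sliceRight_mul_one_tmul, ← hA.sum_comul_antipode_mul, Finset.mul_sum,
      hA.comul_apply]
    simp only [map_sum, sliceRight_tmul, map_smul, LinearMap.sum_apply, LinearMap.smul_apply,
      antipodeAct_apply]
    refine Finset.sum_congr rfl fun l _ => ?_
    rw [← mul_assoc, ← Bialgebra.comul_mul, sliceRight_mul_tmul_one, hτ, smul_mul_assoc, one_mul,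
      map_smul, smul_eq_mul, smul_eq_mul, mul_comm]
  have h2 : ∀ g : Module.Dual k H, dualTmul φ g (Coalgebra.comul (R := k) x) =
      ((Module.Dual.eval k _ (Coalgebra.comul (R := k) x)) ∘ₗ TensorProduct.dualDistrib k H H ∘ₗ
        TensorProduct.mk k _ _ φ) g := fun g => rfl
  rw [h2]
  simp only [map_sum, map_smul, LinearMap.sum_apply, LinearMap.smul_apply, key]
  rfl

/-- For a nonzero left integral `τ`, the map `h ↦ τ(– S(h))` is injective: its kernel is a right
ideal and a right subcomodule of `H`. -/
lemma antipodeAct_injective {τ : Module.Dual k H} (hτ : τ ∈ hopfLeftIntegrals k H) (h0 : τ ≠ 0) :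
    Function.Injective (antipodeAct τ) := by
  rw [← LinearMap.ker_eq_bot]
  by_contra hN
  have h1 := one_mem_of_right_ideal_subcomodule (LinearMap.ker (antipodeAct τ))
    (fun x hx h => by
      rw [LinearMap.mem_ker] at hx ⊢
      refine LinearMap.ext fun y => ?_
      rw [antipodeAct_apply, HopfAlgebra.antipode_mul_antidistrib, ← mul_assoc,
        ← antipodeAct_apply, hx, LinearMap.zero_apply, LinearMap.zero_apply])
    (fun x hx φ => by
      rw [LinearMap.mem_ker] at hx ⊢
      refine LinearMap.ext fun y => ?_
      rw [antipodeAct_sliceRight hτ, hx, dualTmul, TensorProduct.tmul_zero, map_zero,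
        LinearMap.zero_apply, LinearMap.zero_apply])
    hN
  refine h0 (LinearMap.ext fun x => ?_)
  have h2 := DFunLike.congr_fun (LinearMap.mem_ker.1 h1) x
  rwa [antipodeAct_apply, HopfAlgebra.antipode_one, mul_one] at h2

variable [FiniteDimensional k H]

variable (k H) in
/-- The projection of `H*` onto the left integrals: `f ↦ ∑ᵢ (eⁱ * f)(– S²(eᵢ))`. It is the map
`m ↦ m₀ S(m₁)` onto the coinvariants of the Hopf module `H*`, whose coaction is dual to convolution
and on which `h` acts by `f ↦ f(– S(h))`. -/
def integralProj (f : Module.Dual k H) : Module.Dual k H :=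
  ∑ i, convDual k H ((Module.finBasis k H).coord i) f ∘ₗ
    LinearMap.mulRight k (HopfAlgebra.antipode k (HopfAlgebra.antipode k (Module.finBasis k H i)))

lemma integralProj_apply (f : Module.Dual k H) (x : H) :
    integralProj k H f x = ∑ i, convDual k H ((Module.finBasis k H).coord i) f
      (x * HopfAlgebra.antipode k (HopfAlgebra.antipode k (Module.finBasis k H i))) := by
  simp [integralProj, LinearMap.sum_apply]

/-- Every functional is recovered from the Hopf module projection, as `m = (m₀ S(m₁)) m₂`. -/
lemma sum_integralProj (f : Module.Dual k H) (x : H) :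
    ∑ j, integralProj k H (convDual k H ((Module.finBasis k H).coord j) f)
      (x * HopfAlgebra.antipode k (Module.finBasis k H j)) = f x := by
  set b := Module.finBasis k H
  -- `Ω(a ⊗ c) = x S(S(a) c)`
  let Ω : H ⊗[k] H →ₗ[k] H := LinearMap.mulLeft k x ∘ₗ HopfAlgebra.antipode k ∘ₗ
    LinearMap.mul' k H ∘ₗ (HopfAlgebra.antipode k).rTensor H
  let G : Module.Dual k H →ₗ[k] (H ⊗[k] H) →ₗ[k] k :=
    LinearMap.lcomp k k Ω ∘ₗ (convDual k H).flip f
  have hG : ∀ ν a c, G ν (a ⊗ₜ[k] c) = convDual k H ν f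
      (x * HopfAlgebra.antipode k c * HopfAlgebra.antipode k (HopfAlgebra.antipode k a)) := by
    intro ν a c
    simp [G, Ω, HopfAlgebra.antipode_mul_antidistrib, mul_assoc]
  have hGΔ : ∀ ν c, G ν (Coalgebra.comul (R := k) c) =
      Coalgebra.counit (R := k) c * convDual k H ν f x := by
    intro ν c
    simp only [G, Ω, LinearMap.comp_apply, LinearMap.lcomp_apply, LinearMap.flip_apply,
      HopfAlgebra.mul_antipode_rTensor_comul_apply, Algebra.algebraMap_eq_smul_one, map_smul,
      HopfAlgebra.antipode_one, LinearMap.mulLeft_apply, mul_one, smul_eq_mul]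
  calc ∑ j, integralProj k H (convDual k H (b.coord j) f) (x * HopfAlgebra.antipode k (b j))
      = ∑ i, ∑ j, G (convDual k H (b.coord i) (b.coord j)) (b i ⊗ₜ[k] b j) := by
        rw [Finset.sum_comm]
        simp_rw [integralProj_apply, hG, convDual_assoc]
        rfl
    _ = ∑ m, Coalgebra.counit (R := k) (b m) * convDual k H (b.coord m) f x := by
        rw [← sum_coord_comul]
        simp_rw [hGΔ]
    _ = convDual k H (∑ m, Coalgebra.counit (R := k) (b m) • b.coord m) f x := by
        simp only [map_sum, map_smul, LinearMap.sum_apply, LinearMap.smul_apply, smul_eq_mul]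
    _ = f x := by
        have h2 : ∑ m, Coalgebra.counit (R := k) (b m) • b.coord m =
            Coalgebra.counit (R := k) (A := H) := by
          refine b.ext fun i => ?_
          simp
        rw [h2, counit_convDual]

/-- The Hopf module projection takes values in the left integrals. -/
lemma integralProj_mem (f : Module.Dual k H) : integralProj k H f ∈ hopfLeftIntegrals k H := by
  rw [mem_leftIntegrals_iff]
  intro x
  rw [← sub_eq_zero, ← Module.forall_dual_apply_eq_zero_iff k]
  intro μ
  rw [map_sub, sub_eq_zero, map_smul, ← dualTmul_eq, smul_eq_mul]
  set b := Module.finBasis k H with hb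
  let S₂ : H →ₗ[k] H := HopfAlgebra.antipode k ∘ₗ HopfAlgebra.antipode k
  -- `Ω(a ⊗ c) = Δ(x S²(c)) (S(a) ⊗ 1)`
  let Ω : H ⊗[k] H →ₗ[k] H ⊗[k] H := LinearMap.mul' k (H ⊗[k] H) ∘ₗ
    TensorProduct.map (Coalgebra.comul ∘ₗ LinearMap.mulLeft k x ∘ₗ S₂)
      ((Algebra.TensorProduct.includeLeft (R := k) (S := k) (A := H) (B := H)).toLinearMap ∘ₗ
        HopfAlgebra.antipode k) ∘ₗ (TensorProduct.comm k H H).toLinearMap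
  let G : Module.Dual k H →ₗ[k] (H ⊗[k] H) →ₗ[k] k :=
    LinearMap.lcomp k k Ω ∘ₗ TensorProduct.dualDistrib k H H ∘ₗ TensorProduct.mk k _ _ μ ∘ₗ
      (convDual k H).flip f
  have hΩ : ∀ a c, Ω (a ⊗ₜ[k] c) = Coalgebra.comul (R := k) (x * S₂ c) *
      (HopfAlgebra.antipode k a ⊗ₜ[k] 1) := by
    intro a c
    simp [Ω]
  have hΩΔ : Ω ∘ₗ Coalgebra.comul = LinearMap.mulLeft k (Coalgebra.comul (R := k) x) ∘ₗ
      TensorProduct.mk k H H 1 ∘ₗ S₂ :=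
    linearMap_ext_of_isComatrix fun n A hA i j => by
      simp only [LinearMap.comp_apply, hA.comul_apply, map_sum, hΩ, Bialgebra.comul_mul,
        mul_assoc, ← Finset.mul_sum]
      exact congrArg _ (hA.antipode_transpose.sum_comul_antipode_mul j i)
  calc dualTmul μ (integralProj k H f) (Coalgebra.comul (R := k) x)
      = ∑ m, G (b.coord m) (Coalgebra.comul (R := k) (b m)) := by
        have h1 : ∀ m, G (b.coord m) (Coalgebra.comul (R := k) (b m)) =
            dualTmul μ (convDual k H (b.coord m) f ∘ₗ LinearMap.mulRight k (S₂ (b m)))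
              (Coalgebra.comul (R := k) x) := by
          intro m
          have h2 := DFunLike.congr_fun hΩΔ (b m)
          simp only [LinearMap.comp_apply] at h2
          simp only [G, LinearMap.comp_apply, LinearMap.lcomp_apply, h2, dualTmul_eq,
            LinearMap.flip_apply, TensorProduct.mk_apply, LinearMap.mulLeft_apply]
          rw [sliceRight_mul_one_tmul]
        simp_rw [h1]
        simp [integralProj, dualTmul, TensorProduct.tmul_sum, LinearMap.sum_apply, S₂, hb]
    _ = ∑ j, ∑ i, dualTmul μ (convDual k H (b.coord i) (convDual k H (b.coord j) f))
          (Coalgebra.comul (R := k) (x * S₂ (b j)) *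
            (HopfAlgebra.antipode k (b i) ⊗ₜ[k] 1)) := by
        rw [sum_coord_comul, Finset.sum_comm]
        refine Finset.sum_congr rfl fun j _ => Finset.sum_congr rfl fun i _ => ?_
        simp only [G, LinearMap.comp_apply, LinearMap.lcomp_apply, hΩ, LinearMap.flip_apply,
          TensorProduct.mk_apply, convDual_assoc]
    _ = integralProj k H f x * μ 1 := by
        simp_rw [sum_dualTmul_convDual, ← Finset.mul_sum]
        rw [integralProj_apply, mul_comm]
        rfl

/-- A finite-dimensional Hopf algebra has a nonzero left integral in its dual. -/
theorem exists_ne_zero_mem_hopfLeftIntegrals : ∃ τ ∈ hopfLeftIntegrals k H, τ ≠ 0 := by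
  by_contra! h
  have h1 : ∀ x : H, Coalgebra.counit (R := k) x = 0 := by
    intro x
    rw [← sum_integralProj (Coalgebra.counit (R := k) (A := H)) x]
    exact Finset.sum_eq_zero fun j _ => by rw [h _ (integralProj_mem _), LinearMap.zero_apply]
  have h2 := h1 1
  simp at h2

/-- Over a finite-dimensional Hopf algebra the left integrals in the dual are unique up to a
scalar: a second integral has the form `τ(– S(h))`, and then `Δ(h) = h ⊗ 1`. -/
theorem hopfLeftIntegrals_eq_span {τ : Module.Dual k H} (hτ : τ ∈ hopfLeftIntegrals k H)
    (h0 : τ ≠ 0) : hopfLeftIntegrals k H = k ∙ τ := by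
  refine le_antisymm (fun σ hσ => ?_) ((Submodule.span_singleton_le_iff_mem _ _).2 hτ)
  have hinj := antipodeAct_injective hτ h0
  obtain ⟨h, rfl⟩ := (LinearMap.injective_iff_surjective_of_finrank_eq_finrank
    (Subspace.dual_finrank_eq (K := k) (V := H)).symm).1 hinj σ
  have h1 : ∀ φ : Module.Dual k H, sliceRight φ (Coalgebra.comul (R := k) h) = φ 1 • h := by
    intro φ
    apply hinj
    refine LinearMap.ext fun x => ?_
    rw [antipodeAct_sliceRight hτ, dualTmul_eq, mem_leftIntegrals_iff.1 hσ, map_smul, map_smul,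
      LinearMap.smul_apply, smul_eq_mul, smul_eq_mul, mul_comm]
  have h2 : h = Coalgebra.counit (R := k) h • 1 := by
    rw [← sub_eq_zero, ← Module.forall_dual_apply_eq_zero_iff k]
    intro φ
    have h3 := congrArg (Coalgebra.counit (R := k)) (h1 φ)
    rw [apply_sliceRight, sliceLeft_counit_comul, map_smul, smul_eq_mul] at h3
    rw [map_sub, map_smul, h3, smul_eq_mul, mul_comm, sub_self]
  rw [h2, map_smul]
  refine Submodule.smul_mem _ _ ?_
  have h4 : antipodeAct τ 1 = τ := LinearMap.ext fun x => by
    rw [antipodeAct_apply, HopfAlgebra.antipode_one, mul_one]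
  rw [h4]
  exact Submodule.mem_span_singleton_self τ

end DualHopfModule

/-! ### Integrals on `B ⊘ B` and on the Hopf envelope -/

section Transport

variable {k : Type v} {B H : Type u} [Field k] [Ring B] [Bialgebra k B] [Ring H] [HopfAlgebra k H]

lemma sliceRight_map {M N P Q : Type*} [AddCommGroup M] [Module k M] [AddCommGroup N] [Module k N]
    [AddCommGroup P] [Module k P] [AddCommGroup Q] [Module k Q] (f : Module.Dual k Q)
    (g : M →ₗ[k] P) (h : N →ₗ[k] Q) (z : M ⊗[k] N) :
    sliceRight f (TensorProduct.map g h z) = g (sliceRight (f ∘ₗ h) z) := by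
  induction z with
  | zero => simp
  | add x y hx hy => simp only [map_add, hx, hy]
  | tmul x y => simp

/-- Along a surjective coalgebra map, left integrals on the target can be tested on the source. -/
lemma mem_leftIntegrals_iff_of_surjective {C D : Type*} [AddCommGroup C] [Module k C]
    [CoalgebraStruct k C] [AddCommGroup D] [Module k D] [CoalgebraStruct k D] {p : C →ₗ[k] D}
    (hp : Function.Surjective p) (hcomul : ∀ c, Coalgebra.comul (R := k) (p c) =
      TensorProduct.map p p (Coalgebra.comul (R := k) c)) {e : D} {f : Module.Dual k D} :
    f ∈ leftIntegrals k D e ↔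
      ∀ c, p (sliceRight (f ∘ₗ p) (Coalgebra.comul (R := k) c)) = f (p c) • e := by
  rw [mem_leftIntegrals_iff, hp.forall]
  simp_rw [hcomul, sliceRight_map]

lemma IsComatrix.map (q : B →ₐc[k] H) {n : ℕ} {A : Matrix (Fin n) (Fin n) B}
    (hA : IsComatrix k A) : IsComatrix k (A.map q) where
  comul_apply i j := by
    rw [Matrix.map_apply, ← CoalgHomClass.map_comp_comul_apply, hA.comul_apply, map_sum]
    rfl
  counit_apply i j := by
    rw [Matrix.map_apply, CoalgHomClass.counit_comp_apply, hA.counit_apply]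

variable {q : B →ₐc[k] H}

/-- `q̂` applied to `(x₁ ⊘ y₂) f(x₂ ⊘ y₁)`, for `y` an entry of a comatrix. -/
lemma hat_sliceRight_comul_oslash (f : Module.Dual k (Oslash k B)) (x : B) {n : ℕ}
    {A : Matrix (Fin n) (Fin n) B} (hA : IsComatrix k A) (i j : Fin n) :
    hat q (sliceRight f (Coalgebra.comul (R := k) (oslash k x (A i j)))) =
      ∑ m, q (sliceRight (f ∘ₗ (oslash k).flip (A i m)) (Coalgebra.comul (R := k) x)) *
        HopfAlgebra.antipode k (q (A m j)) := by
  rw [comul_oslash]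
  simp only [copComul, AlgHom.comp_apply, Algebra.TensorProduct.map_tmul,
    Bialgebra.comulAlgHom_apply, hA.comul_apply]
  generalize Coalgebra.comul (R := k) x = z
  induction z with
  | zero => simp
  | add x y hx hy => simp only [map_add, TensorProduct.add_tmul, hx, hy, add_mul,
      Finset.sum_add_distrib]
  | tmul x y =>
    simp only [map_sum, TensorProduct.tmul_sum]
    refine Finset.sum_congr rfl fun m _ => ?_
    rw [sliceRight_tmul, map_smul, smul_mul_assoc]
    change hat q (sliceRight f (oslash k x (A m j) ⊗ₜ[k] oslash k y (A i m))) = _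
    rw [sliceRight_tmul, map_smul, hat_oslash]
    rfl

variable [IsArtinianRing B]

lemma hat_bijective (hq : Function.Surjective q) (hker : ∀ x, q x = 0 ↔ iMap k B x = 0) :
    Function.Bijective (hat q) := by
  refine ⟨(injective_iff_map_eq_zero _).2 fun w hw => ?_, fun y => ?_⟩
  · obtain ⟨x, rfl⟩ := iMap_surjective w
    rw [hat_iMap] at hw
    exact (hker x).1 hw
  · obtain ⟨x, rfl⟩ := hq y
    exact ⟨iMap k B x, hat_iMap q x⟩

/-- Left integrals on `H` correspond to left integrals on `B ⊘ B` along `q̂ : B ⊘ B ≃ H`. -/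
lemma comp_hat_mem_iff (hq : Function.Surjective q) (hker : ∀ x, q x = 0 ↔ iMap k B x = 0)
    (τ : Module.Dual k H) :
    τ ∘ₗ hat q ∈ oslashLeftIntegrals k B ↔ τ ∈ hopfLeftIntegrals k H := by
  have hcomp : (τ ∘ₗ hat q) ∘ₗ iMap k B = τ ∘ₗ (q : B →ₗ[k] H) :=
    LinearMap.ext fun x => congrArg τ (hat_iMap q x)
  rw [mem_leftIntegrals_iff_of_surjective (p := (q : B →ₗ[k] H)) hq
      (fun c => (CoalgHomClass.map_comp_comul_apply q c).symm),
    mem_leftIntegrals_iff_of_surjective (p := iMap k B) iMap_surjective comul_iMap, hcomp]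
  refine forall_congr' fun x => ?_
  rw [← (hat_bijective hq hker).1.eq_iff, hat_iMap, map_smul, ← iMap_apply, hat_iMap,
    LinearMap.comp_apply, hat_iMap, map_one]
  rfl

/-- The two notions of left integral on `B ⊘ B` agree. An integral of the pre-dual is a usual one
by specialising to `y = 1`. Conversely, with `H` the Hopf envelope, a usual integral satisfies
`x₁ S(y₂) f(x₂ ⊘ y₁) = f(x ⊘ y) 1` in `H`, and one replaces `y` by `y₁` and multiplies by `y₂` on
the right. -/
theorem predualLeftIntegrals_eq (hq : Function.Surjective q)
    (hker : ∀ x, q x = 0 ↔ iMap k B x = 0) :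
    predualLeftIntegrals k B = oslashLeftIntegrals k B := by
  ext f
  constructor
  · intro hf
    rw [mem_leftIntegrals_iff_of_surjective (p := iMap k B) iMap_surjective comul_iMap]
    intro x
    have h1 := hf x 1
    rw [Bialgebra.comul_one, Algebra.TensorProduct.one_def, LinearMap.rTensor_tmul,
      TensorProduct.lid_tmul, map_smul] at h1
    exact h1
  · intro hf x y
    change iMap k B (sliceRight (f ∘ₗ (oslash k).flip y) (Coalgebra.comul (R := k) x)) =
      iMap k B (sliceLeft (f ∘ₗ oslash k x) (Coalgebra.comul (R := k) y))
    apply (hat_bijective hq hker).1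
    rw [hat_iMap, hat_iMap]
    let L : B →ₗ[k] H := (q : B →ₗ[k] H) ∘ₗ sliceRight f ∘ₗ
      LinearMap.applyₗ (Coalgebra.comul (R := k) x) ∘ₗ LinearMap.lTensorHom B ∘ₗ (oslash k).flip
    have hL : ∀ y, L y =
        q (sliceRight (f ∘ₗ (oslash k).flip y) (Coalgebra.comul (R := k) x)) :=
      fun y => congrArg q (sliceRight_map f LinearMap.id _ _)
    have key : L = (q : B →ₗ[k] H) ∘ₗ sliceLeft (f ∘ₗ oslash k x) ∘ₗ Coalgebra.comul := by
      refine linearMap_ext_of_isComatrix fun n A hA i j => ?_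
      have h1 : ∀ r, ∑ m, L (A i m) * HopfAlgebra.antipode k (q (A m r)) =
          algebraMap k H (f (oslash k x (A i r))) := by
        intro r
        simp_rw [hL]
        rw [← hat_sliceRight_comul_oslash f x hA, mem_leftIntegrals_iff.1 hf, map_smul, hat_oslash,
          map_one, HopfAlgebra.antipode_one, mul_one, Algebra.algebraMap_eq_smul_one]
      calc L (A i j)
          = ∑ m, L (A i m) * ∑ r, HopfAlgebra.antipode k (q (A m r)) * q (A r j) := by
            have h2 := fun m => (hA.map q).antipode_mul m j
            simp only [Matrix.map_apply] at h2
            simp_rw [h2]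
            simp
        _ = ∑ r, algebraMap k H (f (oslash k x (A i r))) * q (A r j) := by
            simp_rw [← h1, Finset.mul_sum, Finset.sum_mul, mul_assoc]
            exact Finset.sum_comm
        _ = _ := by
            rw [LinearMap.comp_apply, LinearMap.comp_apply, hA.comul_apply, map_sum, map_sum]
            refine Finset.sum_congr rfl fun r _ => ?_
            rw [sliceLeft_tmul, map_smul, ← Algebra.smul_def]
            rfl
    rw [← hL, key]
    rfl

/-- The left integrals of the pre-dual are spanned by `τ ∘ q̂`, for any nonzero left integral `τ`
of the Hopf envelope. -/
theorem predualLeftIntegrals_eq_span [FiniteDimensional k H] (hq : Function.Surjective q)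
    (hker : ∀ x, q x = 0 ↔ iMap k B x = 0) {τ : Module.Dual k H}
    (hτ : τ ∈ hopfLeftIntegrals k H) (h0 : τ ≠ 0) :
    predualLeftIntegrals k B = Submodule.span k {τ ∘ₗ hat q} := by
  rw [predualLeftIntegrals_eq hq hker]
  refine le_antisymm (fun f hf => ?_)
    ((Submodule.span_singleton_le_iff_mem _ _).2 ((comp_hat_mem_iff hq hker τ).2 hτ))
  let e : Oslash k B ≃ₗ[k] H := LinearEquiv.ofBijective (hat q) (hat_bijective hq hker)
  have hfe : f = (f ∘ₗ e.symm.toLinearMap) ∘ₗ hat q :=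
    LinearMap.ext fun w => congrArg f (e.symm_apply_apply w).symm
  rw [hfe, comp_hat_mem_iff hq hker, hopfLeftIntegrals_eq_span hτ h0] at hf
  obtain ⟨c, hc⟩ := Submodule.mem_span_singleton.1 hf
  rw [hfe, ← hc]
  exact Submodule.mem_span_singleton.2 ⟨c, rfl⟩

theorem finrank_predualLeftIntegrals [FiniteDimensional k H] (hq : Function.Surjective q)
    (hker : ∀ x, q x = 0 ↔ iMap k B x = 0) :
    Module.finrank k (predualLeftIntegrals k B) = 1 := by
  obtain ⟨τ, hτ, h0⟩ := exists_ne_zero_mem_hopfLeftIntegrals (k := k) (H := H)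
  rw [predualLeftIntegrals_eq_span hq hker hτ h0]
  refine finrank_span_singleton fun h => h0 (LinearMap.ext fun y => ?_)
  obtain ⟨w, rfl⟩ := (hat_bijective hq hker).2 y
  exact DFunLike.congr_fun h w

end Transport

end BialgIntegral

end

open BialgIntegral in
theorem mainTheorem3 {k : Type v} [Field k] (B : Type u) [Ring B] [Bialgebra k B]
    (hB : FiniteDimensional k B ∨ IsArtinianRing B) :
    predualLeftIntegrals k B = oslashLeftIntegrals k B ∧
    Module.finrank k (predualLeftIntegrals k B) = 1 ∧
    (∃ (H : Type u) (_ : Ring H) (_ : HopfAlgebra k H) (q : B →ₐc[k] H),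
      IsHopfEnvelope q ∧ Function.Surjective q ∧ ∀ x : B, q x = 0 ↔ iMap k B x = 0) ∧
    ∀ (H : Type u) [Ring H] [HopfAlgebra k H] (q : B →ₐc[k] H), IsHopfEnvelope q →
      FiniteDimensional k H ∧
      (∃ τ ∈ hopfLeftIntegrals k H, τ ≠ 0) ∧
      ∀ τ ∈ hopfLeftIntegrals k H, τ ≠ 0 →
        predualLeftIntegrals k B = Submodule.span k {τ ∘ₗ hat q} := by
  have hart : IsArtinianRing B := hB.elim (fun _ => IsArtinianRing.of_finite k B) id
  have hfin : ∀ (H : Type u) [Ring H] [HopfAlgebra k H] (q : B →ₐc[k] H),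
      Function.Surjective q → FiniteDimensional k H := by
    intro H _ _ q hq
    have : IsArtinianRing H :=
      Function.Surjective.isArtinianRing (f := (q : B →ₐ[k] H).toRingHom) hq
    exact finiteDimensional_of_isArtinianRing
  have hker : ∀ x : B, quotMap k B x = 0 ↔ iMap k B x = 0 := fun x => quotMap_eq_zero
  refine ⟨predualLeftIntegrals_eq quotMap_surjective hker, ?_,
    ⟨B ⧸ kerIdeal k B, Ideal.Quotient.ring _, quotHopfAlgebra, quotMap k B, isHopfEnvelope_quotMap,
      quotMap_surjective, hker⟩, ?_⟩
  · have := hfin _ (quotMap k B) quotMap_surjective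
    exact finrank_predualLeftIntegrals quotMap_surjective hker
  · intro H _ _ q hq
    obtain ⟨hsurj, hker'⟩ := hq.surjective_and_ker
    have := hfin H q hsurj
    exact ⟨this, exists_ne_zero_mem_hopfLeftIntegrals, fun τ hτ h0 =>
      predualLeftIntegrals_eq_span hsurj hker' hτ h0⟩
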